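/- Fix a dimension $d\ge 2$ and write $\omega=e^{2\pi i/d}$, $F|n\rangle=d^{-1/2}\sum_m\omega^{mn}|m\rangle$, $|+_0\rangle=F|0\rangle$, $R(\theta)|n\rangle=e^{i\theta_n}|n\rangle$ and $v(\theta)=FR(\theta)$ for $\theta\in\mathbb R^d$; dits are elements of $\mathbb Z/d$. A *measurement pattern* $P$ consists of a finite set $V$ of $d$-level systems (qudits), sets $I,O\subseteq V$ of input and output qudits, and a finite sequence of commands: entangling commands $E_{ij}=CZ_{ij}$ ($i\ne j$), corrections $X_i^{s}$ and $Z_i^{s}$, and destructive measurements ${}_t[M_i^{\theta}]^s$ of qudit $i$ in the basis $v(\Lambda)^\dagger|j\rangle$, $\Lambda_j=\theta_{j+s}+tj\,2\pi/d$, with outcome $j\in\mathbb Z/d$. Here $s,t$ are sums modulo $d$ of outcomes of earlier measurements and of their additive inverses; no command acts on a measured qudit and no output is measured. Non-input qudits are prepared in $|+_0\rangle$. An *unbounded fan-out circuit* is defined in the same way, but its operations are the gates $CZ$, $v(\theta)$ ($\theta\in\mathbb R^d$) and, for any number $n$ of targets, $\mathrm{FANOUT}\,|x\rangle|y_1,\dots,y_n\rangle=|x\rangle|y_1+x,\dots,y_n+x\rangle$,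 and its non-input qudits are prepared in $|0\rangle$. The *size* is the sum over all operations of the number of qudits on which they act. The *depth* is the length of the longest subsequence of operations in which each operation acts on a qudit in common with, or depends on the outcome of, the previous one in the subsequence. A computation *implements* a unitary $U$ if for every input state $|\psi\rangle$ the final state of the output qudits is $U|\psi\rangle$ (up to a global phase, whatever the measurement outcomes). There is a constant $C$, depending only on $d$, such that the following holds for every measurement pattern $P$ which implements some unitary, or in which, more generally, every output qudit that is not an input is acted on by at least one command. There is an unbounded fan-out circuit $\mathfrak F$, with the same input and output labels, which maps every input state to the same output state (density operator of the output qudits, all other qudits being traced out and the measurement outcomes averaged over) as $P$ does, and which in particular implements every unitary that $P$ implements, such that $$\mathrm{depth}(\mathfrak F)\le C\,\mathrm{depth}(P),\qquad \mathrm{size}(\mathfrak F)\le C\,\mathrm{size}(P)^2\,\mathrm{depth}(P).$$ -/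

import Mathlib

open scoped Matrix

universe u v w

noncomputable section

/-! ## Depth and size of a sequence of operations -/

/-- The number of operations in the longest path of dependent operations of the sequence `l`:
a path is a subsequence in which every operation stands in the relation `dep` to the one
immediately before it in the subsequence. -/
def longestPath {α : Type*} (dep : α → α → Prop) (l : List α) : ℕ :=
  sSup {n | ∃ p : List α, p.Sublist l ∧ p.IsChain dep ∧ p.length = n}

theorem longestPath_bddAbove {α : Type*} (dep : α → α → Prop) (l : List α) :
    BddAbove {n | ∃ p : List α, p.Sublist l ∧ p.IsChain dep ∧ p.length = n} := by
  refine ⟨l.length, ?_⟩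
  rintro n ⟨p, hp, -, rfl⟩
  exact hp.length_le

theorem length_le_longestPath {α : Type*} {dep : α → α → Prop} {l p : List α}
    (hp : p.Sublist l) (hc : p.IsChain dep) : p.length ≤ longestPath dep l :=
  le_csSup (longestPath_bddAbove dep l) ⟨p, hp, hc, rfl⟩

theorem exists_longestPath {α : Type*} (dep : α → α → Prop) (l : List α) :
    ∃ p : List α, p.Sublist l ∧ p.IsChain dep ∧ p.length = longestPath dep l :=
  Nat.sSup_mem (s := {n | ∃ p : List α, p.Sublist l ∧ p.IsChain dep ∧ p.length = n})
    ⟨0, [], List.nil_sublist l, List.isChain_nil, rfl⟩ (longestPath_bddAbove dep l)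

/-! ## Qudits, states and operators

A register of `d`-level systems labelled by `V` has the computational basis `V → ZMod d`. Operators
and density operators are matrices over that basis. `ZMod.stdAddChar k` is `ω ^ k` with
`ω = exp (2πi / d)`. -/

/-- Operators (in particular density operators) on the qudits labelled by `V`. -/
abbrev QuditOp (d : ℕ) (V : Type*) := Matrix (V → ZMod d) (V → ZMod d) ℂ

/-- The operator `A` on the single qudit `i`, tensored with the identity on all the others. -/
def onQudit {d : ℕ} {V : Type*} [Fintype V] [DecidableEq V] (i : V)
    (A : Matrix (ZMod d) (ZMod d) ℂ) : QuditOp d V :=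
  Matrix.of fun x y => if ∀ k, k ≠ i → x k = y k then A (x i) (y i) else 0

/-- The Fourier transform `F |n⟩ = d^(-1/2) ∑ m, ω^(m n) |m⟩`. -/
def fourierGate (d : ℕ) [NeZero d] : Matrix (ZMod d) (ZMod d) ℂ :=
  Matrix.of fun m n => ZMod.stdAddChar (m * n) / (Real.sqrt d : ℂ)

/-- The rotation gate `R(θ) |n⟩ = exp (i θ_n) |n⟩`. -/
def rotationGate {d : ℕ} (θ : ZMod d → ℝ) : Matrix (ZMod d) (ZMod d) ℂ :=
  Matrix.diagonal fun n => Complex.exp (Complex.I * (θ n : ℂ))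

/-- `v(θ) = F R(θ)`. -/
def vGate {d : ℕ} [NeZero d] (θ : ZMod d → ℝ) : Matrix (ZMod d) (ZMod d) ℂ :=
  fourierGate d * rotationGate θ

/-- `X^s |n⟩ = |n + s⟩`. -/
def pauliXPow {d : ℕ} (s : ZMod d) : Matrix (ZMod d) (ZMod d) ℂ :=
  Matrix.of fun m n => if m = n + s then 1 else 0

/-- `Z^s |n⟩ = ω^(s n) |n⟩`. -/
def pauliZPow {d : ℕ} [NeZero d] (s : ZMod d) : Matrix (ZMod d) (ZMod d) ℂ :=
  Matrix.diagonal fun n => ZMod.stdAddChar (s * n)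

/-- The controlled-`Z` operator on the qudits `i` and `j`. -/
def czOp {d : ℕ} [NeZero d] {V : Type*} [Fintype V] [DecidableEq V] (i j : V) : QuditOp d V :=
  Matrix.diagonal fun x => ZMod.stdAddChar (x i * x j)

/-- The fan-out operator with control `c` and set of targets `T`: it adds the dit of `c` to the dit
of every qudit in `T`. -/
def fanoutOp {d : ℕ} {V : Type*} [Fintype V] [DecidableEq V] (c : V) (T : Finset V) :
    QuditOp d V :=
  Matrix.of fun x y => if x = (fun k => if k ∈ T then y k + y c else y k) then 1 else 0

/-- The joint state of all the qudits in `V` when the qudits `inp i` carry the input state `ρ` and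
each of the remaining qudits is prepared in the pure state `a`. -/
def initialState {d : ℕ} {V I : Type*} [Fintype V] [DecidableEq V] [Fintype I]
    (inp : I ↪ V) (a : ZMod d → ℂ) (ρ : QuditOp d I) : QuditOp d V :=
  Matrix.of fun x y => ρ (fun i => x (inp i)) (fun i => y (inp i)) *
    ∏ k ∈ Finset.univ \ Finset.univ.map inp, a (x k) * star (a (y k))

/-- The reduced state of the qudits `out o`: all the other qudits are traced out. -/
def outputState {d : ℕ} [NeZero d] {V O : Type*} [Fintype V] [DecidableEq V] [Fintype O]
    (out : O ↪ V) (ρ : QuditOp d V) : QuditOp d O :=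
  Matrix.of fun a b => ∑ x : V → ZMod d, ∑ y : V → ZMod d,
    if (∀ o, x (out o) = a o) ∧ (∀ o, y (out o) = b o) ∧
      (∀ k, k ∉ Finset.univ.map out → x k = y k) then ρ x y else 0

/-- The input-output map `Φ` implements the unitary `U`: `U` is unitary, and for every input state
`|ψ⟩` the state of the output qudits is `U |ψ⟩`. -/
def ImplementsUnitary {d : ℕ} [NeZero d] {I O : Type*} [Fintype I] [DecidableEq I] [Fintype O]
    [DecidableEq O] (Φ : QuditOp d I → QuditOp d O)
    (U : Matrix (O → ZMod d) (I → ZMod d) ℂ) : Prop :=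
  Uᴴ * U = 1 ∧ U * Uᴴ = 1 ∧
    ∀ ψ : (I → ZMod d) → ℂ,
      Φ (Matrix.vecMulVec ψ (star ψ)) = Matrix.vecMulVec (U *ᵥ ψ) (star (U *ᵥ ψ))

/-! ## Measurement patterns -/

/-- A classical signal: a sum modulo `d` of measurement outcomes and of their additive inverses.
`s i` is the multiplicity modulo `d` with which the outcome of the measurement of qudit `i` is
taken. -/
abbrev DitSignal (d : ℕ) (V : Type*) := V → ZMod d

/-- The value of a signal when the recorded measurement outcomes are `r`. -/
def DitSignal.value {d : ℕ} {V : Type*} [Fintype V] (s : DitSignal d V) (r : V → ZMod d) : ZMod d :=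
  ∑ i, s i * r i

/-- The qudits on the outcomes of which a signal depends. -/
def DitSignal.support {d : ℕ} {V : Type*} [Fintype V] (s : DitSignal d V) : Finset V :=
  Finset.univ.filter fun i => s i ≠ 0

/-- The commands of a measurement pattern: the entangling command `E i j`, the corrections
`X_i^s` and `Z_i^s`, and the destructive measurement `M_i^θ` with dependencies `s` (`X`-type) and
`t` (`Z`-type); the measurement is independent if `s = t = 0`. -/
inductive PatternCommand (d : ℕ) (V : Type*) where
  | entangle (i j : V) : PatternCommand d V
  | correctX (i : V) (s : DitSignal d V) : PatternCommand d V
  | correctZ (i : V) (s : DitSignal d V) : PatternCommand d V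
  | measure (i : V) (θ : ZMod d → ℝ) (s t : DitSignal d V) : PatternCommand d V

namespace PatternCommand

variable {d : ℕ} {V : Type*} [Fintype V] [DecidableEq V]

/-- The qudits on which a command acts. -/
def qudits : PatternCommand d V → Finset V
  | entangle i j => {i, j}
  | correctX i _ => {i}
  | correctZ i _ => {i}
  | measure i _ _ _ => {i}

/-- The qudits on the measurement outcomes of which a command depends. -/
def reads : PatternCommand d V → Finset V
  | entangle _ _ => ∅
  | correctX _ s => s.support
  | correctZ _ s => s.support
  | measure _ _ s t => s.support ∪ t.support

/-- The qudits that a command measures (and destroys). -/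
def measured : PatternCommand d V → Finset V
  | entangle _ _ => ∅
  | correctX _ _ => ∅
  | correctZ _ _ => ∅
  | measure i _ _ _ => {i}

/-- An entangling command acts on two distinct qudits. -/
def Valid : PatternCommand d V → Prop
  | entangle i j => i ≠ j
  | correctX _ _ => True
  | correctZ _ _ => True
  | measure _ _ _ _ => True

/-- `b` directly depends on the earlier command `a`: it acts on a qudit in common with `a`, or
depends on the outcome of `a`. -/
def DependsOn (a b : PatternCommand d V) : Prop :=
  ¬ Disjoint a.qudits b.qudits ∨ ¬ Disjoint a.measured b.reads

/-- The sequence can be carried out when the qudits in `D` have already been measured: no command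
acts on a measured qudit, and commands depend only on outcomes that have been obtained. -/
def Runnable : Finset V → List (PatternCommand d V) → Prop
  | _, [] => True
  | D, c :: cs => c.Valid ∧ Disjoint c.qudits D ∧ c.reads ⊆ D ∧ Runnable (D ∪ c.measured) cs

/-- The vector `Λ(θ, s, t)` with entries `Λ_j = θ_{j+s} + t j (2π / d)`. -/
def angles (θ : ZMod d → ℝ) (s t : ZMod d) : ZMod d → ℝ :=
  fun j => θ (j + s) + (t.val : ℝ) * (j.val : ℝ) * (2 * Real.pi / d)

variable [NeZero d]

/-- The projector onto `|j_(θ,s,t)⟩ = v(Λ(θ,s,t))† |j⟩`. -/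
def measProj (θ : ZMod d → ℝ) (s t j : ZMod d) : Matrix (ZMod d) (ZMod d) ℂ :=
  (vGate (angles θ s t))ᴴ * Matrix.single j j 1 * vGate (angles θ s t)

/-- The state after a sequence of commands, started with the recorded outcomes `r` and the state
`ρ`. A measurement records its outcome, and the sum is over all outcomes, each branch being
weighted by its probability. The measured qudit is kept, in its post-measurement state, until it is
traced out at the end; no later command acts on it. -/
def run : List (PatternCommand d V) → (V → ZMod d) → QuditOp d V → QuditOp d V
  | [], _, ρ => ρ
  | entangle i j :: cs, r, ρ => run cs r (czOp i j * ρ * (czOp i j)ᴴ)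
  | correctX i s :: cs, r, ρ =>
      run cs r (onQudit i (pauliXPow (s.value r)) * ρ * (onQudit i (pauliXPow (s.value r)))ᴴ)
  | correctZ i s :: cs, r, ρ =>
      run cs r (onQudit i (pauliZPow (s.value r)) * ρ * (onQudit i (pauliZPow (s.value r)))ᴴ)
  | measure i θ s t :: cs, r, ρ =>
      ∑ j : ZMod d, run cs (Function.update r i j)
        (onQudit i (measProj θ (s.value r) (t.value r) j) * ρ *
          (onQudit i (measProj θ (s.value r) (t.value r) j))ᴴ)

end PatternCommand

/-- A measurement pattern on the set `V` of qudits. The input and output subsets of `V` are the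
images of `inp` and `out` (and may overlap); the first command of the list is carried out first. -/
structure MeasurementPattern (d : ℕ) (V I O : Type*) [Fintype V] [DecidableEq V] where
  inp : I ↪ V
  out : O ↪ V
  commands : List (PatternCommand d V)
  runnable : PatternCommand.Runnable ∅ commands
  out_not_measured : ∀ c ∈ commands, ∀ o, out o ∉ c.measured

namespace MeasurementPattern

variable {d : ℕ} {V I O : Type*} [Fintype V] [DecidableEq V]

/-- The quantum depth of a pattern. -/
def depth (P : MeasurementPattern d V I O) : ℕ :=
  longestPath PatternCommand.DependsOn P.commands

/-- The quantum size of a pattern. -/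
def size (P : MeasurementPattern d V I O) : ℕ :=
  (P.commands.map fun c => c.qudits.card).sum

/-- The map from input states to output states; all non-input qudits are prepared in
`|+_0⟩ = F |0⟩`. -/
def channel [NeZero d] [Fintype I] [Fintype O] (P : MeasurementPattern d V I O)
    (ρ : QuditOp d I) : QuditOp d O :=
  outputState P.out
    (PatternCommand.run P.commands 0 (initialState P.inp (fun n => fourierGate d n 0) ρ))

/-- Every output qudit that is not an input is acted on by at least one command. -/
def NoIdleOutput (P : MeasurementPattern d V I O) : Prop :=
  ∀ o, P.out o ∉ Set.range P.inp → ∃ c ∈ P.commands, P.out o ∈ c.qudits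

end MeasurementPattern

/-! ## Unbounded fan-out circuits -/

/-- The gate set: controlled-`Z`, the single-qudit gates `v(θ)`, and fan-out gates on any number of
qudits. -/
inductive FanoutGate (d : ℕ) (V : Type*) where
  | cz (i j : V) : FanoutGate d V
  | local1 (i : V) (θ : ZMod d → ℝ) : FanoutGate d V
  | fanout (c : V) (T : Finset V) : FanoutGate d V

namespace FanoutGate

variable {d : ℕ} {V : Type*} [Fintype V] [DecidableEq V]

/-- The qudits on which a gate acts. -/
def qudits : FanoutGate d V → Finset V
  | cz i j => {i, j}
  | local1 i _ => {i}
  | fanout c T => insert c T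

/-- A gate acts on distinct qudits. -/
def Valid : FanoutGate d V → Prop
  | cz i j => i ≠ j
  | local1 _ _ => True
  | fanout c T => c ∉ T

/-- `b` acts on a qudit in common with `a`. -/
def DependsOn (a b : FanoutGate d V) : Prop :=
  ¬ Disjoint a.qudits b.qudits

/-- The unitary operator of a gate. -/
def op [NeZero d] : FanoutGate d V → QuditOp d V
  | cz i j => czOp i j
  | local1 i θ => onQudit i (vGate θ)
  | fanout c T => fanoutOp c T

/-- The state after a sequence of gates, applied to the state `ρ`. -/
def run [NeZero d] : List (FanoutGate d V) → QuditOp d V → QuditOp d V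
  | [], ρ => ρ
  | g :: gs, ρ => run gs (g.op * ρ * (g.op)ᴴ)

end FanoutGate

/-- An unbounded fan-out circuit on the set `W` of qudits, with inputs and outputs as for a
measurement pattern. -/
structure FanoutCircuit (d : ℕ) (W I O : Type*) [Fintype W] [DecidableEq W] where
  inp : I ↪ W
  out : O ↪ W
  gates : List (FanoutGate d W)
  valid : ∀ g ∈ gates, g.Valid

namespace FanoutCircuit

variable {d : ℕ} {W I O : Type*} [Fintype W] [DecidableEq W]

/-- The quantum depth of a circuit. -/
def depth (F : FanoutCircuit d W I O) : ℕ :=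
  longestPath FanoutGate.DependsOn F.gates

/-- The quantum size of a circuit. -/
def size (F : FanoutCircuit d W I O) : ℕ :=
  (F.gates.map fun g => g.qudits.card).sum

/-- The map from input states to output states; all non-input qudits are prepared in `|0⟩`. -/
def channel [NeZero d] [Fintype I] [Fintype O] (F : FanoutCircuit d W I O)
    (ρ : QuditOp d I) : QuditOp d O :=
  outputState F.out (FanoutGate.run F.gates (initialState F.inp (Pi.single 0 1) ρ))

end FanoutCircuit

end

set_option linter.unusedSectionVars false

/-! ## Operators on single qudits -/

section Operators

variable {d : ℕ} [NeZero d] {V : Type*} [Fintype V] [DecidableEq V]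

/-! The simulation rests on deferred measurement. A measurement in the basis `v(Λ)† |j⟩` is a
unitary followed by a measurement in the computational basis, and since `v(Λ) = Z^(-s) v(θ) X^s
Z^t`, with a phase `Z^(-s)` that the projectors do not see, adaptivity amounts to a correction `X^s
Z^t` before a fixed gate. A measured qudit is afterwards used only as a classical control, that is,
diagonally, and it is traced out at the end. So the outcome can be left in the qudit and every
signal read coherently (`outputState_run`).

It remains to carry out a coherent `Z_i^s` in constant depth however many outcomes `s` involves;
`X_i^s = F³ Z_i^s F` then follows. The operator is the product of the phases `ω^(s_j x_j x_i)`,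
which commute but all share the qudit `i`. A fan-out copies `x_i` once for each outcome that is
read, the phases then act on disjoint pairs, and `d - 1` more fan-outs erase the copies
(`ops_signalZGates`). Commands on different qudits may read the same outcome at the same time, so
each measurement fans its outcome out to one copy per potential reader. The map `withCopies`
intertwines circuit and coherent pattern (`ops_flatMap_gates`), and the outcome copies disappear in
the partial trace (`outputState_withCopies`).

For the depth, each command becomes a block of gates of depth `O(d)`, and gates from independent
commands share no wire (`not_touches_of_not_dependsOn`). A path of gates therefore projects to a
path of commands (`exists_path_of_flatMap`). For the size, a block involves at most `O(size)`
copies.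

The circuit starts from `|0⟩` instead of `|+_0⟩`, which costs one layer of Fourier gates, on the
non-input qudits that occur in some command. Qudits in no command can be left out only if they are
not outputs. This is why idle outputs are excluded; a pattern that implements a unitary has none
(`noIdleOutput_of_implementsUnitary`). -/

theorem onQudit_mul_apply {β : Type*} (i : V) (A : Matrix (ZMod d) (ZMod d) ℂ)
    (M : Matrix (V → ZMod d) β ℂ) (x : V → ZMod d) (y : β) :
    (onQudit i A * M) x y = ∑ m, A (x i) m * M (Function.update x i m) y := by
  rw [Matrix.mul_apply]
  symm
  refine Finset.sum_of_injOn (fun m => Function.update x i m) ?_ ?_ ?_ ?_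
  · intro a _ b _ h
    exact Function.update_injective x i h
  · intro a _
    simp
  · intro z _ hz
    have : ¬ ∀ k, k ≠ i → x k = z k := by
      intro h
      refine hz ⟨z i, by simp, ?_⟩
      funext k
      by_cases hk : k = i
      · subst hk; simp
      · simp [hk, h k hk]
    simp [onQudit, this]
  · intro m _
    have : ∀ k, k ≠ i → x k = Function.update x i m k := fun k hk => by simp [hk]
    simp only [onQudit, Matrix.of_apply, if_pos this, Function.update_self]

theorem onQudit_transpose (i : V) (A : Matrix (ZMod d) (ZMod d) ℂ) :
    (onQudit i A)ᵀ = onQudit i Aᵀ := by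
  ext x y
  simp only [onQudit, Matrix.transpose_apply, Matrix.of_apply, eq_comm]

theorem mul_onQudit_apply {β : Type*} (i : V) (A : Matrix (ZMod d) (ZMod d) ℂ)
    (M : Matrix β (V → ZMod d) ℂ) (x : β) (y : V → ZMod d) :
    (M * onQudit i A) x y = ∑ m, M x (Function.update y i m) * A m (y i) := by
  rw [← Matrix.transpose_apply (M * onQudit i A), Matrix.transpose_mul, onQudit_transpose,
    onQudit_mul_apply]
  simp [mul_comm]

theorem onQudit_conjTranspose (i : V) (A : Matrix (ZMod d) (ZMod d) ℂ) :
    (onQudit i A)ᴴ = onQudit i Aᴴ := by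
  ext x y
  simp only [onQudit, Matrix.conjTranspose_apply, Matrix.of_apply, eq_comm]
  split_ifs <;> simp

theorem onQudit_mul_onQudit (i : V) (A B : Matrix (ZMod d) (ZMod d) ℂ) :
    onQudit i A * onQudit i B = onQudit i (A * B) := by
  ext x y
  rw [onQudit_mul_apply]
  have h : ∀ m, (∀ k, k ≠ i → Function.update x i m k = y k) ↔ ∀ k, k ≠ i → x k = y k :=
    fun m => forall₂_congr fun k hk => by simp [hk]
  simp only [onQudit, Matrix.of_apply, h, Function.update_self, Matrix.mul_apply]
  split_ifs <;> simp

theorem onQudit_diagonal (i : V) (f : ZMod d → ℂ) :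
    onQudit i (Matrix.diagonal f) = Matrix.diagonal fun x : V → ZMod d => f (x i) := by
  ext x y
  by_cases hxy : x = y
  · subst hxy; simp [onQudit]
  · rw [Matrix.diagonal_apply_ne _ hxy]
    by_cases h : ∀ k, k ≠ i → x k = y k
    · have : x i ≠ y i := fun hi => hxy <| funext fun k => by
        by_cases hk : k = i
        · rw [hk, hi]
        · exact h k hk
      simp only [onQudit, Matrix.of_apply, if_pos h, Matrix.diagonal_apply_ne _ this]
    · simp only [onQudit, Matrix.of_apply, if_neg h]

theorem onQudit_one (i : V) : onQudit i (1 : Matrix (ZMod d) (ZMod d) ℂ) = 1 := by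
  rw [← Matrix.diagonal_one, onQudit_diagonal, Matrix.diagonal_one]

/-- The operator `M` is the identity on the qudit `i`, tensored with an operator on the others. -/
def TrivialAt (i : V) (M : QuditOp d V) : Prop :=
  (∀ x y, x i ≠ y i → M x y = 0) ∧
    ∀ x y m, x i = y i → M (Function.update x i m) (Function.update y i m) = M x y

/-- In each product only one term of the sum survives, because `M` preserves the dit of `i`. The two
surviving entries of `M` differ by a simultaneous change of that dit, which does not affect them. -/
theorem TrivialAt.commute {i : V} {M : QuditOp d V} (h : TrivialAt i M)
    (A : Matrix (ZMod d) (ZMod d) ℂ) : Commute M (onQudit i A) := by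
  ext x y
  rw [onQudit_mul_apply, mul_onQudit_apply, Finset.sum_eq_single (x i),
    Finset.sum_eq_single (y i)]
  · have := h.2 (Function.update x i (y i)) y (x i) (by simp)
    simp only [Function.update_idem, Function.update_eq_self] at this
    rw [this, mul_comm]
  · intro m _ hm
    rw [h.1 _ _ (by simpa using hm), mul_zero]
  · simp
  · intro m _ hm
    rw [h.1 _ _ (by simpa using hm.symm), zero_mul]
  · simp

theorem trivialAt_onQudit {i j : V} (hij : i ≠ j) (B : Matrix (ZMod d) (ZMod d) ℂ) :
    TrivialAt i (onQudit j B) := by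
  constructor
  · intro x y hxy
    have : ¬ ∀ k, k ≠ j → x k = y k := fun h => hxy (h i hij)
    simp [onQudit, this]
  · intro x y m hxy
    have : (∀ k, k ≠ j → Function.update x i m k = Function.update y i m k) ↔
        ∀ k, k ≠ j → x k = y k := by
      refine forall₂_congr fun k _ => ?_
      by_cases hk : k = i
      · subst hk; simp [hxy]
      · simp [hk]
    simp only [onQudit, Matrix.of_apply, this, Function.update_of_ne hij.symm]

theorem trivialAt_diagonal {i : V} {f : (V → ZMod d) → ℂ}
    (hf : ∀ x m, f (Function.update x i m) = f x) : TrivialAt i (Matrix.diagonal f) := by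
  constructor
  · intro x y hxy
    exact Matrix.diagonal_apply_ne _ fun h => hxy (by rw [h])
  · intro x y m hxy
    by_cases h : x = y
    · subst h; simp [hf]
    · have : Function.update x i m ≠ Function.update y i m := by
        intro h'
        refine h (funext fun k => ?_)
        by_cases hk : k = i
        · rw [hk, hxy]
        · simpa [hk] using congrFun h' k
      rw [Matrix.diagonal_apply_ne _ h, Matrix.diagonal_apply_ne _ this]

theorem trivialAt_czOp {i j k : V} (hj : i ≠ j) (hk : i ≠ k) :
    TrivialAt i (czOp j k : QuditOp d V) :=
  trivialAt_diagonal fun x m => by simp [hj.symm, hk.symm]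

/-! ## The partial trace -/

/-- The operator whose Hilbert-Schmidt pairing with a state is the entry `(a, b)` of the reduced
state. -/
def reducedEntry {O : Type*} [Fintype O] (out : O ↪ V) (a b : O → ZMod d) :
    QuditOp d V :=
  Matrix.of fun y x => if (∀ o, x (out o) = a o) ∧ (∀ o, y (out o) = b o) ∧
      (∀ k, k ∉ Finset.univ.map out → x k = y k) then 1 else 0

variable {O : Type*} [Fintype O] (out : O ↪ V)

theorem outputState_eq_trace (ρ : QuditOp d V) (a b : O → ZMod d) :
    outputState out ρ a b = (ρ * reducedEntry out a b).trace := by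
  simp only [outputState, reducedEntry, Matrix.trace, Matrix.diag, Matrix.mul_apply,
    Matrix.of_apply, mul_ite, mul_one, mul_zero]

theorem trivialAt_reducedEntry {i : V} (hi : i ∉ Set.range out) (a b : O → ZMod d) :
    TrivialAt i (reducedEntry out a b) := by
  have hi' : i ∉ Finset.univ.map out := by simpa using hi
  have ho : ∀ o, out o ≠ i := fun o h => hi ⟨o, h⟩
  constructor
  · intro y x h
    simp only [reducedEntry, Matrix.of_apply]
    rw [if_neg]
    rintro ⟨-, -, h'⟩
    exact h (h' i hi').symm
  · intro y x m h
    simp only [reducedEntry, Matrix.of_apply, Function.update_of_ne (ho _)]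
    congr 3
    refine propext <| forall₂_congr fun k _ => ?_
    by_cases hk : k = i
    · subst hk; simp [h]
    · simp [hk]

/-- By cyclicity of the trace, `A` meets its adjoint across `reducedEntry`, with which it commutes.
The lemma removes both the rotations left over from destructive measurements and the preparation of
unused qudits. -/
theorem outputState_unitary_conj {i : V} (hi : i ∉ Set.range out)
    {A : Matrix (ZMod d) (ZMod d) ℂ} (hA : Aᴴ * A = 1) (ρ : QuditOp d V) :
    outputState out (onQudit i A * ρ * (onQudit i A)ᴴ) = outputState out ρ := by
  ext a b
  have hc := (trivialAt_reducedEntry out hi a b).commute A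
  rw [outputState_eq_trace, outputState_eq_trace, Matrix.mul_assoc, Matrix.mul_assoc,
    Matrix.trace_mul_comm, Matrix.mul_assoc, Matrix.mul_assoc, hc.eq,
    ← Matrix.mul_assoc (onQudit i A)ᴴ, onQudit_conjTranspose, onQudit_mul_onQudit, hA,
    onQudit_one, Matrix.one_mul]

theorem outputState_sum {ι : Type*} (s : Finset ι) (ρ : ι → QuditOp d V) :
    outputState out (∑ j ∈ s, ρ j) = ∑ j ∈ s, outputState out (ρ j) := by
  ext a b
  simp only [Matrix.sum_apply, outputState_eq_trace, Finset.sum_mul, Matrix.trace_sum]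

theorem sum_onQudit_single (i : V) :
    ∑ j : ZMod d, onQudit i (Matrix.single j j (1 : ℂ)) = (1 : QuditOp d V) := by
  simp only [← Matrix.diagonal_single, onQudit_diagonal]
  ext x y
  rw [Matrix.sum_apply]
  by_cases h : x = y
  · subst h
    simp [Pi.single_apply]
  · simp [h]

/-- The projectors commute with `reducedEntry`, are idempotent and add up to the identity. Read from
right to left, this inserts a measurement of a qudit that is to be discarded. -/
theorem outputState_dephase {i : V} (hi : i ∉ Set.range out) (ρ : QuditOp d V) :
    ∑ j : ZMod d, outputState out (onQudit i (Matrix.single j j 1) * ρ *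
      (onQudit i (Matrix.single j j 1))ᴴ) = outputState out ρ := by
  ext a b
  have hP : ∀ j : ZMod d, outputState out (onQudit i (Matrix.single j j 1) * ρ *
      (onQudit i (Matrix.single j j 1))ᴴ) a b =
      (onQudit i (Matrix.single j j 1) * (ρ * reducedEntry out a b)).trace := by
    intro j
    have hc := (trivialAt_reducedEntry out hi a b).commute (Matrix.single j j 1)
    rw [outputState_eq_trace, onQudit_conjTranspose, Matrix.conjTranspose_single, star_one,
      Matrix.mul_assoc, ← hc.eq, ← Matrix.mul_assoc, Matrix.trace_mul_comm, ← Matrix.mul_assoc,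
      ← Matrix.mul_assoc, onQudit_mul_onQudit, Matrix.single_mul_single_same, one_mul,
      Matrix.mul_assoc]
  rw [Matrix.sum_apply, outputState_eq_trace]
  simp only [hP]
  rw [← Matrix.trace_sum, ← Finset.sum_mul, sum_onQudit_single, Matrix.one_mul]

/-! ## Operators induced by maps of the computational basis -/

/-- The operator `|x⟩ ↦ |f x⟩`. -/
def basisMap {α β : Type*} [DecidableEq β] (f : α → β) : Matrix β α ℂ :=
  Matrix.of fun w x => if w = f x then 1 else 0

theorem basisMap_mul_basisMap {α β γ : Type*} [Fintype β] [DecidableEq β] [DecidableEq γ]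
    (g : β → γ) (f : α → β) : basisMap g * basisMap f = basisMap (g ∘ f) := by
  ext w x
  simp [basisMap, Matrix.mul_apply]

theorem diagonal_mul_basisMap {α β : Type*} [Fintype α] [DecidableEq α] [Fintype β]
    [DecidableEq β] (δ : β → ℂ) (f : α → β) :
    Matrix.diagonal δ * basisMap f = basisMap f * Matrix.diagonal (δ ∘ f) := by
  ext w x
  simp only [basisMap, Matrix.diagonal_mul, Matrix.mul_diagonal, Matrix.of_apply,
    Function.comp_apply]
  split_ifs with h <;> simp [h]

theorem basisMap_conjTranspose_mul_mul {α β : Type*} [Fintype β]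
    [DecidableEq β] (M : Matrix β β ℂ) (f : α → β) :
    (basisMap f)ᴴ * M * basisMap f = M.submatrix f f := by
  ext x y
  simp [basisMap, Matrix.mul_apply, Matrix.conjTranspose_apply, apply_ite]

theorem basisMap_id {α : Type*} [DecidableEq α] : basisMap (id : α → α) = 1 := by
  ext x y
  simp [basisMap, Matrix.one_apply]

/-! ## Single-qudit gates -/

theorem fourierGate_mul_self : fourierGate d * fourierGate d = basisMap Neg.neg := by
  ext m n
  have hd : (Real.sqrt d : ℂ) * Real.sqrt d = d := by
    rw [← Complex.ofReal_mul, Real.mul_self_sqrt (Nat.cast_nonneg d)]; simp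
  have hd0 : (d : ℂ) ≠ 0 := Nat.cast_ne_zero.2 (NeZero.ne d)
  have hs := AddChar.sum_mulShift (m + n) (ZMod.isPrimitive_stdAddChar d)
  have key : ∀ k : ZMod d, fourierGate d m k * fourierGate d k n =
      ZMod.stdAddChar (k * (m + n)) / (d : ℂ) := by
    intro k
    simp only [fourierGate, Matrix.of_apply]
    rw [div_mul_div_comm, hd, ← AddChar.map_add_eq_mul]
    congr 2; ring
  rw [Matrix.mul_apply]
  simp only [key]
  rw [← Finset.sum_div, hs]
  simp only [basisMap, Matrix.of_apply, ZMod.card, eq_neg_iff_add_eq_zero]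
  split_ifs <;> simp [hd0]

theorem fourierGate_conjTranspose :
    (fourierGate d)ᴴ = fourierGate d * fourierGate d * fourierGate d := by
  rw [Matrix.mul_assoc, fourierGate_mul_self]
  ext m n
  simp only [Matrix.conjTranspose_apply, Matrix.mul_apply, basisMap, Matrix.of_apply, mul_ite,
    mul_one, mul_zero, Finset.sum_ite_eq', Finset.mem_univ, if_true, fourierGate]
  rw [star_div₀, mul_neg, AddChar.map_neg_eq_conj, mul_comm n m]
  simp

theorem fourierGate_conjTranspose_mul_self : (fourierGate d)ᴴ * fourierGate d = 1 := by
  rw [fourierGate_conjTranspose, fourierGate_mul_self, Matrix.mul_assoc, fourierGate_mul_self,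
    basisMap_mul_basisMap, neg_comp_neg, basisMap_id]

theorem fourierGate_mul_pauliXPow (s : ZMod d) :
    fourierGate d * pauliXPow s = pauliZPow s * fourierGate d := by
  ext m n
  rw [pauliZPow, Matrix.diagonal_mul]
  simp only [Matrix.mul_apply, pauliXPow, Matrix.of_apply, mul_ite,
    mul_one, mul_zero, Finset.sum_ite_eq', Finset.mem_univ, if_true, fourierGate]
  rw [mul_div_assoc', ← AddChar.map_add_eq_mul]
  congr 2; ring

/-- `F` diagonalises the shift, and `F†` equals `F³` because `F²` is `n ↦ -n`. Thus only `F = v(0)`,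
and no inverse, is needed from the gate set. -/
theorem pauliXPow_eq (s : ZMod d) :
    pauliXPow s = fourierGate d * fourierGate d * fourierGate d * pauliZPow s * fourierGate d := by
  rw [Matrix.mul_assoc, ← fourierGate_mul_pauliXPow, ← fourierGate_conjTranspose,
    ← Matrix.mul_assoc, fourierGate_conjTranspose_mul_self, Matrix.one_mul]

theorem pauliZPow_conjTranspose_mul_self (s : ZMod d) : (pauliZPow s)ᴴ * pauliZPow s = 1 := by
  rw [pauliZPow, Matrix.diagonal_conjTranspose, Matrix.diagonal_mul_diagonal,
    ← Matrix.diagonal_one]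
  congr 1
  funext n
  simp only [Pi.star_apply]
  rw [RCLike.star_def, ← AddChar.map_neg_eq_conj, ← AddChar.map_add_eq_mul]
  simp

theorem vGate_zero : vGate (0 : ZMod d → ℝ) = fourierGate d := by
  simp [vGate, rotationGate]

theorem vGate_conjTranspose_mul_self (θ : ZMod d → ℝ) : (vGate θ)ᴴ * vGate θ = 1 := by
  rw [vGate, Matrix.conjTranspose_mul, Matrix.mul_assoc, ← Matrix.mul_assoc (fourierGate d)ᴴ,
    fourierGate_conjTranspose_mul_self, Matrix.one_mul, rotationGate,
    Matrix.diagonal_conjTranspose, Matrix.diagonal_mul_diagonal, ← Matrix.diagonal_one]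
  congr 1
  funext n
  simp only [Pi.star_apply]
  rw [RCLike.star_def, ← Complex.exp_conj, ← Complex.exp_add]
  simp

theorem conjTranspose_mul_self_mul {n : Type*} [Fintype n] [DecidableEq n] {A B : Matrix n n ℂ}
    (hA : Aᴴ * A = 1) (hB : Bᴴ * B = 1) : (A * B)ᴴ * (A * B) = 1 := by
  rw [Matrix.conjTranspose_mul, Matrix.mul_assoc, ← Matrix.mul_assoc Aᴴ, hA, Matrix.one_mul, hB]

theorem pauliXPow_conjTranspose_mul_self (s : ZMod d) : (pauliXPow s)ᴴ * pauliXPow s = 1 := by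
  have hF := fourierGate_conjTranspose_mul_self (d := d)
  rw [pauliXPow_eq]
  exact conjTranspose_mul_self_mul (conjTranspose_mul_self_mul (conjTranspose_mul_self_mul
    (conjTranspose_mul_self_mul hF hF) hF) (pauliZPow_conjTranspose_mul_self s)) hF

/-- The gate that carries the basis of the measurement with signal values `s` and `t` to the
computational basis, up to phases. -/
noncomputable def measGate (θ : ZMod d → ℝ) (s t : ZMod d) : Matrix (ZMod d) (ZMod d) ℂ :=
  vGate θ * pauliXPow s * pauliZPow t

theorem measGate_conjTranspose_mul_self (θ : ZMod d → ℝ) (s t : ZMod d) :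
    (measGate θ s t)ᴴ * measGate θ s t = 1 :=
  conjTranspose_mul_self_mul (conjTranspose_mul_self_mul (vGate_conjTranspose_mul_self θ)
    (pauliXPow_conjTranspose_mul_self s)) (pauliZPow_conjTranspose_mul_self t)

/-- Reindexing the angles by `n ↦ n + s` is composition with `X^s`, the linear term in the angles is
`Z^t`, and `ω^(mn) = ω^(-sm) ω^(m(n+s))` produces the phase on the left. That phase is diagonal, so
it drops out of the measurement projectors. -/
theorem vGate_angles (θ : ZMod d → ℝ) (s t : ZMod d) :
    vGate (PatternCommand.angles θ s t) = pauliZPow (-s) * measGate θ s t := by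
  ext m n
  have ht : (ZMod.stdAddChar (t * n) : ℂ) =
      Complex.exp (Complex.I * ((t.val : ℝ) * (n.val : ℝ) * (2 * Real.pi / d) : ℝ)) := by
    have := ZMod.stdAddChar_coe (N := d) ((t.val * n.val : ℕ) : ℤ)
    have h2 : (((t.val * n.val : ℕ) : ℤ) : ZMod d) = t * n := by simp
    rw [h2] at this
    rw [this]
    congr 1
    push_cast
    ring
  have h1 : ∀ y : ZMod d, (vGate θ * pauliXPow s) m y = vGate θ m (y + s) := by
    intro y
    simp [Matrix.mul_apply, pauliXPow]
  rw [measGate, pauliZPow, Matrix.diagonal_mul, pauliZPow, Matrix.mul_diagonal, h1, ht]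
  simp only [vGate, rotationGate, Matrix.mul_diagonal, fourierGate, Matrix.of_apply,
    PatternCommand.angles]
  have h3 : (ZMod.stdAddChar (m * n) : ℂ) =
      ZMod.stdAddChar (-s * m) * ZMod.stdAddChar (m * (n + s)) := by
    rw [← AddChar.map_add_eq_mul]
    congr 1; ring
  rw [h3, Complex.ofReal_add, mul_add Complex.I, Complex.exp_add]
  ring

theorem measProj_eq (θ : ZMod d → ℝ) (s t j : ZMod d) :
    PatternCommand.measProj θ s t j =
      (measGate θ s t)ᴴ * Matrix.single j j 1 * measGate θ s t := by
  have hc : (pauliZPow (-s))ᴴ * Matrix.single j j (1 : ℂ) * pauliZPow (-s) =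
      Matrix.single j j 1 := by
    have : Matrix.single j j (1 : ℂ) * pauliZPow (-s) = pauliZPow (-s) * Matrix.single j j 1 := by
      rw [← Matrix.diagonal_single, pauliZPow, Matrix.diagonal_mul_diagonal,
        Matrix.diagonal_mul_diagonal]
      simp only [mul_comm]
    rw [Matrix.mul_assoc, this, ← Matrix.mul_assoc, pauliZPow_conjTranspose_mul_self,
      Matrix.one_mul]
  rw [PatternCommand.measProj, vGate_angles, Matrix.conjTranspose_mul]
  calc _ = (measGate θ s t)ᴴ * ((pauliZPow (-s))ᴴ * Matrix.single j j (1 : ℂ) * pauliZPow (-s)) *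
        measGate θ s t := by simp only [Matrix.mul_assoc]
    _ = _ := by rw [hc]

end Operators

/-! ## Deferred measurements -/

section Deferred

variable {d : ℕ} [NeZero d] {V : Type*} [Fintype V] [DecidableEq V]

theorem TrivialAt.conjTranspose {i : V} {M : QuditOp d V} (h : TrivialAt i M) :
    TrivialAt i Mᴴ := by
  refine ⟨fun x y hxy => ?_, fun x y m hxy => ?_⟩
  · rw [Matrix.conjTranspose_apply, h.1 _ _ (Ne.symm hxy), star_zero]
  · rw [Matrix.conjTranspose_apply, h.2 _ _ _ hxy.symm, Matrix.conjTranspose_apply]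

theorem TrivialAt.conj_mul {i : V} {M : QuditOp d V} (h : TrivialAt i M)
    (A B : Matrix (ZMod d) (ZMod d) ℂ) (ρ : QuditOp d V) :
    M * (onQudit i A * ρ * onQudit i B) * Mᴴ = onQudit i A * (M * ρ * Mᴴ) * onQudit i B := by
  calc M * (onQudit i A * ρ * onQudit i B) * Mᴴ
      = M * onQudit i A * ρ * (onQudit i B * Mᴴ) := by simp only [Matrix.mul_assoc]
    _ = onQudit i A * M * ρ * (Mᴴ * onQudit i B) := by
        rw [(h.commute A).eq, (h.conjTranspose.commute B).eq]
    _ = _ := by simp only [Matrix.mul_assoc]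

namespace PatternCommand

/-- The operators on the two sides are independent, so that besides conjugation the one-sided
product (`B = 1`) is covered. -/
theorem run_onQudit_mul_mul {i : V} (A B : Matrix (ZMod d) (ZMod d) ℂ) :
    ∀ (cs : List (PatternCommand d V)), (∀ c ∈ cs, i ∉ c.qudits) → ∀ r ρ,
      run cs r (onQudit i A * ρ * onQudit i B) = onQudit i A * run cs r ρ * onQudit i B
  | [], _, r, ρ => rfl
  | c :: cs, h, r, ρ => by
    have hc := h c (by simp)
    have ih := run_onQudit_mul_mul A B cs fun c hc => h c (by simp [hc])
    cases c with
    | entangle j k =>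
      simp only [qudits, Finset.mem_insert, Finset.mem_singleton, not_or] at hc
      simp only [run]
      rw [(trivialAt_czOp hc.1 hc.2).conj_mul, ih]
    | correctX j s =>
      simp only [qudits, Finset.mem_singleton] at hc
      simp only [run]
      rw [(trivialAt_onQudit hc _).conj_mul, ih]
    | correctZ j s =>
      simp only [qudits, Finset.mem_singleton] at hc
      simp only [run]
      rw [(trivialAt_onQudit hc _).conj_mul, ih]
    | measure j θ s t =>
      simp only [qudits, Finset.mem_singleton] at hc
      simp only [run]
      rw [Finset.mul_sum, Finset.sum_mul]
      refine Finset.sum_congr rfl fun m _ => ?_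
      rw [(trivialAt_onQudit hc _).conj_mul, ih]

theorem not_mem_qudits_of_runnable {i : V} :
    ∀ {D : Finset V} {cs : List (PatternCommand d V)}, i ∈ D → Runnable D cs →
      ∀ c ∈ cs, i ∉ c.qudits
  | _, [], _, _ => by simp
  | D, c :: cs, hi, h => by
    intro c' hc'
    rcases List.mem_cons.1 hc' with rfl | hc'
    · exact Finset.disjoint_right.1 h.2.1 hi
    · exact not_mem_qudits_of_runnable (Finset.mem_union_left _ hi) h.2.2.2 c' hc'

/-- The operator `Z_i^s` in which the value of `s` is read off coherently. -/
noncomputable def signalZOp (i : V) (s : DitSignal d V) : QuditOp d V :=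
  Matrix.diagonal fun x => ZMod.stdAddChar (s.value x * x i)

/-- The operator `X_i^s` in which the value of `s` is read off coherently. -/
noncomputable def signalXOp (i : V) (s : DitSignal d V) : QuditOp d V :=
  onQudit i (fourierGate d * fourierGate d * fourierGate d) * signalZOp i s *
    onQudit i (fourierGate d)

/-- The unitary operator that carries out a command with its measurement deferred: the outcome is
left in the measured qudit. -/
noncomputable def coherentOp : PatternCommand d V → QuditOp d V
  | entangle i j => czOp i j
  | correctX i s => signalXOp i s
  | correctZ i s => signalZOp i s
  | measure i θ s t => onQudit i (vGate θ) * signalXOp i s * signalZOp i t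

/-- The product of the operators `coherentOp` of a sequence of commands. -/
noncomputable def coherentOps : List (PatternCommand d V) → QuditOp d V
  | [] => 1
  | c :: cs => coherentOps cs * c.coherentOp

/-- The projector onto the states in which the qudits of `D` carry the dits `r`. -/
noncomputable def outcomeProj (D : Finset V) (r : V → ZMod d) : QuditOp d V :=
  Matrix.diagonal fun x => if ∀ k ∈ D, x k = r k then 1 else 0

theorem outcomeProj_empty (r : V → ZMod d) : outcomeProj ∅ r = 1 := by
  simp [outcomeProj]

theorem outcomeProj_conjTranspose (D : Finset V) (r : V → ZMod d) :
    (outcomeProj D r)ᴴ = outcomeProj D r := by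
  rw [outcomeProj, Matrix.diagonal_conjTranspose]
  congr 1
  funext x
  simp only [Pi.star_apply]
  split_ifs <;> simp

theorem trivialAt_outcomeProj {i : V} {D : Finset V} (hi : i ∉ D) (r : V → ZMod d) :
    TrivialAt i (outcomeProj D r) := by
  refine trivialAt_diagonal fun x m => ?_
  congr 1
  refine propext <| forall₂_congr fun k hk => ?_
  rw [Function.update_of_ne (fun h => hi (by rwa [← h]))]

theorem outcomeProj_insert {i : V} {D : Finset V} (hi : i ∉ D) (r : V → ZMod d) (j : ZMod d) :
    outcomeProj (D ∪ {i}) (Function.update r i j) =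
      onQudit i (Matrix.single j j 1) * outcomeProj D r := by
  rw [← Matrix.diagonal_single, onQudit_diagonal, outcomeProj, outcomeProj,
    Matrix.diagonal_mul_diagonal]
  congr 1
  funext x
  have : (∀ k ∈ D ∪ {i}, x k = Function.update r i j k) ↔ x i = j ∧ ∀ k ∈ D, x k = r k := by
    rw [Finset.forall_mem_union, and_comm]
    refine and_congr (by simp) (forall₂_congr fun k hk => ?_)
    rw [Function.update_of_ne (fun h => hi (by rwa [← h]))]
  simp only [this, Pi.single_apply, ite_and]
  split_ifs <;> simp

theorem value_eq_of_support_subset {s : DitSignal d V} {D : Finset V} (hs : s.support ⊆ D)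
    {x r : V → ZMod d} (h : ∀ k ∈ D, x k = r k) : s.value x = s.value r := by
  refine Finset.sum_congr rfl fun i _ => ?_
  by_cases hi : s i = 0
  · simp [hi]
  · rw [h i (hs (by simpa [DitSignal.support] using hi))]

/-- On the range of the projector the dits that the signal reads are fixed, so coherent and
classical control agree. -/
theorem signalZOp_mul_outcomeProj {i : V} {s : DitSignal d V} {D : Finset V}
    (hs : s.support ⊆ D) (r : V → ZMod d) :
    signalZOp i s * outcomeProj D r = onQudit i (pauliZPow (s.value r)) * outcomeProj D r := by
  rw [signalZOp, pauliZPow, onQudit_diagonal, outcomeProj, Matrix.diagonal_mul_diagonal,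
    Matrix.diagonal_mul_diagonal]
  congr 1
  funext x
  split_ifs with h
  · rw [value_eq_of_support_subset hs h]
  · simp

/-- `i ∉ D` lets the Fourier gates on `i` pass the projector, which reduces the claim to the
diagonal case. -/
theorem signalXOp_mul_outcomeProj {i : V} {s : DitSignal d V} {D : Finset V} (hi : i ∉ D)
    (hs : s.support ⊆ D) (r : V → ZMod d) :
    signalXOp i s * outcomeProj D r = onQudit i (pauliXPow (s.value r)) * outcomeProj D r := by
  have hc := (trivialAt_outcomeProj hi r).commute (fourierGate d)
  rw [signalXOp, Matrix.mul_assoc, ← hc.eq, ← Matrix.mul_assoc, Matrix.mul_assoc (onQudit i _),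
    signalZOp_mul_outcomeProj hs, pauliXPow_eq, ← Matrix.mul_assoc, Matrix.mul_assoc, hc.eq,
    ← Matrix.mul_assoc, onQudit_mul_onQudit, onQudit_mul_onQudit]

theorem coherentOp_measure_mul_outcomeProj {i : V} {s t : DitSignal d V} {D : Finset V}
    (hi : i ∉ D) (hs : s.support ⊆ D) (ht : t.support ⊆ D) (θ : ZMod d → ℝ) (r : V → ZMod d) :
    coherentOp (measure i θ s t) * outcomeProj D r =
      onQudit i (measGate θ (s.value r) (t.value r)) * outcomeProj D r := by
  have hc := (trivialAt_outcomeProj hi r).commute (pauliZPow (t.value r))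
  rw [coherentOp, Matrix.mul_assoc, signalZOp_mul_outcomeProj ht, ← hc.eq, ← Matrix.mul_assoc,
    Matrix.mul_assoc (onQudit i _), signalXOp_mul_outcomeProj hi hs, Matrix.mul_assoc,
    Matrix.mul_assoc, hc.eq, ← Matrix.mul_assoc, ← Matrix.mul_assoc, onQudit_mul_onQudit,
    onQudit_mul_onQudit, measGate]

/-- A qudit on which the command does not act can still be read by it, but only as a control in the
computational basis. Hence commutation with diagonal operators, and not with arbitrary ones. -/
theorem commute_coherentOp {i : V} {c : PatternCommand d V} (hi : i ∉ c.qudits)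
    (f : ZMod d → ℂ) : Commute c.coherentOp (onQudit i (Matrix.diagonal f)) := by
  have hZ : ∀ (j : V) (s : DitSignal d V),
      Commute (signalZOp j s) (onQudit i (Matrix.diagonal f)) := by
    intro j s
    rw [onQudit_diagonal, signalZOp]
    exact Matrix.commute_diagonal _ _
  have hX : ∀ (j : V) (s : DitSignal d V), i ≠ j →
      Commute (signalXOp j s) (onQudit i (Matrix.diagonal f)) := fun j s hj =>
    (((trivialAt_onQudit hj _).commute _).mul_left (hZ j s)).mul_left
      ((trivialAt_onQudit hj _).commute _)
  cases c with
  | entangle j k =>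
    simp only [qudits, Finset.mem_insert, Finset.mem_singleton, not_or] at hi
    exact (trivialAt_czOp hi.1 hi.2).commute _
  | correctX j s =>
    simp only [qudits, Finset.mem_singleton] at hi
    exact hX j s hi
  | correctZ j s => exact hZ j s
  | measure j θ s t =>
    simp only [qudits, Finset.mem_singleton] at hi
    exact (((trivialAt_onQudit hi _).commute _).mul_left (hX j s hi)).mul_left (hZ j t)

theorem commute_coherentOps {i : V} (f : ZMod d → ℂ) :
    ∀ {cs : List (PatternCommand d V)}, (∀ c ∈ cs, i ∉ c.qudits) →
      Commute (coherentOps cs) (onQudit i (Matrix.diagonal f))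
  | [], _ => Commute.one_left _
  | c :: cs, h => (commute_coherentOps f fun c' hc' => h c' (by simp [hc'])).mul_left
      (commute_coherentOp (h c (by simp)) f)

/-- The state `ρ` is supported on the states in which the qudits of `D` carry the dits `r`. -/
def Conditioned (D : Finset V) (r : V → ZMod d) (ρ : QuditOp d V) : Prop :=
  outcomeProj D r * ρ = ρ ∧ ρ * outcomeProj D r = ρ

theorem Conditioned.conj {D : Finset V} {r : V → ZMod d} {ρ M : QuditOp d V}
    (h : Conditioned D r ρ) (hM : Commute (outcomeProj D r) M) :
    Conditioned D r (M * ρ * Mᴴ) := by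
  have hM' : Commute (outcomeProj D r) Mᴴ := by
    have := congrArg Matrix.conjTranspose hM.eq
    rw [Matrix.conjTranspose_mul, Matrix.conjTranspose_mul, outcomeProj_conjTranspose] at this
    exact this.symm
  constructor
  · rw [← Matrix.mul_assoc, ← Matrix.mul_assoc, hM.eq, Matrix.mul_assoc M, h.1]
  · rw [Matrix.mul_assoc, ← hM'.eq, ← Matrix.mul_assoc, Matrix.mul_assoc M, h.2]

theorem Conditioned.conj_eq {D : Finset V} {r : V → ZMod d} {ρ M N : QuditOp d V}
    (h : Conditioned D r ρ) (hMN : M * outcomeProj D r = N * outcomeProj D r) :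
    M * ρ * Mᴴ = N * ρ * Nᴴ := by
  have hMN' := congrArg Matrix.conjTranspose hMN
  rw [Matrix.conjTranspose_mul, Matrix.conjTranspose_mul, outcomeProj_conjTranspose] at hMN'
  have key : ∀ K : QuditOp d V, K * ρ * Kᴴ =
      (K * outcomeProj D r) * ρ * (outcomeProj D r * Kᴴ) := fun K => by
    rw [Matrix.mul_assoc K (outcomeProj D r), h.1, ← Matrix.mul_assoc, Matrix.mul_assoc K ρ (outcomeProj D r), h.2]
  rw [key M, key N, hMN, hMN']

theorem Conditioned.measure {D : Finset V} {r : V → ZMod d} {ρ : QuditOp d V} {i : V}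
    (hi : i ∉ D) (h : Conditioned D r ρ) (j : ZMod d) :
    Conditioned (D ∪ {i}) (Function.update r i j)
      (onQudit i (Matrix.single j j 1) * ρ * onQudit i (Matrix.single j j 1)) := by
  have hc := (trivialAt_outcomeProj hi r).commute (Matrix.single j j 1)
  have hP : onQudit i (Matrix.single j j (1 : ℂ)) * onQudit i (Matrix.single j j 1) =
      (onQudit i (Matrix.single j j 1) : QuditOp d V) := by
    rw [onQudit_mul_onQudit, Matrix.single_mul_single_same, one_mul]
  constructor
  · rw [outcomeProj_insert hi, ← hc.eq, ← Matrix.mul_assoc, ← Matrix.mul_assoc,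
      Matrix.mul_assoc (outcomeProj D r), hP, hc.eq, Matrix.mul_assoc _ (outcomeProj D r), h.1]
  · rw [outcomeProj_insert hi, ← Matrix.mul_assoc, Matrix.mul_assoc _ _ (onQudit i _), hP,
      Matrix.mul_assoc, ← hc.eq, ← Matrix.mul_assoc, Matrix.mul_assoc _ ρ, h.2]

/-- The principle of deferred measurement, by induction for states in which the measured qudits `D`
carry the recorded outcomes `r`. On such states each coherent command acts as its classically
controlled version. At a measurement, the coherent side is dephased at `i`, which is allowed because
`i` is traced out, and the two sides are compared outcome by outcome. -/
theorem outputState_run {O : Type*} [Fintype O] (out : O ↪ V)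
    (cs : List (PatternCommand d V)) : ∀ (D : Finset V) (r : V → ZMod d) (ρ : QuditOp d V),
      Runnable D cs → (∀ c ∈ cs, ∀ o, out o ∉ c.measured) → Conditioned D r ρ →
      outputState out (run cs r ρ) = outputState out (coherentOps cs * ρ * (coherentOps cs)ᴴ) := by
  induction cs with
  | nil =>
    intro _ _ ρ _ _ _
    simp [run, coherentOps]
  | cons c cs ih =>
    intro D r ρ hrun hout hρ
    have hout' : ∀ c ∈ cs, ∀ o, out o ∉ c.measured := fun c hc => hout c (by simp [hc])
    obtain ⟨-, hq, hr, hrun'⟩ := hrun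
    have hassoc : coherentOps (c :: cs) * ρ * (coherentOps (c :: cs))ᴴ =
        coherentOps cs * (c.coherentOp * ρ * c.coherentOpᴴ) * (coherentOps cs)ᴴ := by
      simp only [coherentOps, Matrix.conjTranspose_mul, Matrix.mul_assoc]
    rw [hassoc]
    cases c with
    | entangle i j =>
      simp only [qudits, Finset.disjoint_insert_left, Finset.disjoint_singleton_left] at hq
      simp only [measured, Finset.union_empty] at hrun'
      simp only [run, coherentOp]
      refine ih D r _ hrun' hout' (hρ.conj ?_)
      rw [czOp, outcomeProj]
      exact Matrix.commute_diagonal _ _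
    | correctX i s =>
      simp only [qudits, Finset.disjoint_singleton_left] at hq
      simp only [measured, Finset.union_empty] at hrun'
      simp only [run, coherentOp]
      rw [hρ.conj_eq (signalXOp_mul_outcomeProj hq hr r)]
      exact ih D r _ hrun' hout' (hρ.conj ((trivialAt_outcomeProj hq r).commute _))
    | correctZ i s =>
      simp only [qudits, Finset.disjoint_singleton_left] at hq
      simp only [measured, Finset.union_empty] at hrun'
      simp only [run, coherentOp]
      rw [hρ.conj_eq (signalZOp_mul_outcomeProj hr r)]
      exact ih D r _ hrun' hout' (hρ.conj ((trivialAt_outcomeProj hq r).commute _))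
    | measure i θ s t =>
      simp only [qudits, Finset.disjoint_singleton_left] at hq
      simp only [measured] at hrun'
      simp only [reads, Finset.union_subset_iff] at hr
      have hio : i ∉ Set.range out := by
        rintro ⟨o, rfl⟩
        exact hout _ List.mem_cons_self o (by simp [measured])
      have hi : ∀ c ∈ cs, i ∉ c.qudits := not_mem_qudits_of_runnable (by simp) hrun'
      simp only [run]
      rw [hρ.conj_eq (coherentOp_measure_mul_outcomeProj hq hr.1 hr.2 θ r), outputState_sum]
      set W := measGate θ (s.value r) (t.value r) with hW
      have hW1 : W * Wᴴ = 1 := mul_eq_one_comm.1 (measGate_conjTranspose_mul_self _ _ _)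
      set ρ' := onQudit i W * ρ * (onQudit i W)ᴴ with hρ'
      have hcond : Conditioned D r ρ' := hρ.conj ((trivialAt_outcomeProj hq r).commute _)
      -- This splits the coherent side into a sum over outcomes, to be matched with the branches of
      -- the measurement.
      rw [← outputState_dephase out hio]
      refine Finset.sum_congr rfl fun j _ => ?_
      have hPs : (onQudit i (Matrix.single j j (1 : ℂ)) : QuditOp d V)ᴴ =
          onQudit i (Matrix.single j j 1) := by
        rw [onQudit_conjTranspose, Matrix.conjTranspose_single, star_one]
      have hKraus : onQudit i (measProj θ (s.value r) (t.value r) j) * ρ *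
          (onQudit i (measProj θ (s.value r) (t.value r) j))ᴴ =
          onQudit i Wᴴ * (onQudit i (Matrix.single j j 1) * ρ' * onQudit i (Matrix.single j j 1)) *
            (onQudit i W) := by
        rw [measProj_eq, ← hW, hρ', ← onQudit_mul_onQudit, ← onQudit_mul_onQudit,
          Matrix.conjTranspose_mul, Matrix.conjTranspose_mul, hPs, onQudit_conjTranspose i Wᴴ,
          Matrix.conjTranspose_conjTranspose]
        simp only [Matrix.mul_assoc]
      have hW2 : (onQudit i W : QuditOp d V) = (onQudit i Wᴴ)ᴴ := by
        rw [onQudit_conjTranspose, Matrix.conjTranspose_conjTranspose]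
      -- The Kraus operator is `W† P_j W`. No later command acts on `i`, so the outer `W†` moves to
      -- the end of the run, where the partial trace absorbs it.
      rw [hKraus, run_onQudit_mul_mul _ _ _ hi]
      conv_lhs => rw [hW2]
      rw [outputState_unitary_conj out hio (by rwa [Matrix.conjTranspose_conjTranspose]),
        ih _ _ _ hrun' hout' (hcond.measure hq j), hPs]
      -- The projectors inserted at the end of the coherent computation move back to the time of the
      -- measurement, since from then on `i` is only a control.
      have hcc : Commute (coherentOps cs) (onQudit i (Matrix.single j j 1)) := by
        rw [← Matrix.diagonal_single]
        exact commute_coherentOps _ hi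
      have hcc' : Commute (coherentOps cs)ᴴ (onQudit i (Matrix.single j j 1)) := by
        have := congrArg Matrix.conjTranspose hcc.eq
        rw [Matrix.conjTranspose_mul, Matrix.conjTranspose_mul, hPs] at this
        exact this.symm
      congr 1
      calc _ = coherentOps cs * onQudit i (Matrix.single j j 1) * ρ' *
            (onQudit i (Matrix.single j j 1) * (coherentOps cs)ᴴ) := by
              simp only [Matrix.mul_assoc]
        _ = _ := by rw [hcc.eq, ← hcc'.eq]; simp only [Matrix.mul_assoc]

end PatternCommand

end Deferred

/-! ## The operator of a circuit -/

section Circuit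

variable {d : ℕ} [NeZero d] {V : Type*} [Fintype V] [DecidableEq V]

namespace FanoutGate

/-- The product of the operators of a sequence of gates. -/
noncomputable def ops : List (FanoutGate d V) → QuditOp d V
  | [] => 1
  | g :: gs => ops gs * g.op

theorem run_eq (gs : List (FanoutGate d V)) :
    ∀ ρ, run gs ρ = ops gs * ρ * (ops gs)ᴴ := by
  induction gs with
  | nil => simp [run, ops]
  | cons g gs ih =>
    intro ρ
    simp only [run, ops, ih, Matrix.conjTranspose_mul, Matrix.mul_assoc]

theorem ops_append (gs hs : List (FanoutGate d V)) : ops (gs ++ hs) = ops hs * ops gs := by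
  induction gs with
  | nil => simp [ops]
  | cons g gs ih => simp only [List.cons_append, ops, ih, Matrix.mul_assoc]

/-- The map of the computational basis that a fan-out gate carries out. -/
def fanoutMap (c : V) (T : Finset V) (y : V → ZMod d) : V → ZMod d :=
  fun k => if k ∈ T then y k + y c else y k

/-- The control is not a target and so never changes. At `n = d` the map is the identity, hence `d -
1` further fan-outs undo one. -/
theorem fanoutMap_iterate {c : V} {T : Finset V} (hc : c ∉ T) (n : ℕ) (y : V → ZMod d) :
    (fanoutMap c T)^[n] y = fun k => if k ∈ T then y k + n * y c else y k := by
  induction n with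
  | zero => simp
  | succ n ih =>
    rw [Function.iterate_succ_apply', ih]
    funext k
    simp only [fanoutMap, hc, if_false]
    split_ifs
    · push_cast; ring
    · rfl

theorem ops_replicate_fanout (c : V) (T : Finset V) (n : ℕ) :
    ops (List.replicate n (fanout c T : FanoutGate d V)) = basisMap (fanoutMap c T)^[n] := by
  induction n with
  | zero => simp [ops, basisMap_id]
  | succ n ih =>
    rw [List.replicate_succ, ops, ih, Function.iterate_succ]
    exact basisMap_mul_basisMap _ _

theorem ops_replicate_cz (a b : V) (n : ℕ) :
    ops (List.replicate n (cz a b : FanoutGate d V)) =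
      Matrix.diagonal fun x => ZMod.stdAddChar ((n : ZMod d) * (x a * x b)) := by
  induction n with
  | zero => simp [ops]
  | succ n ih =>
    rw [List.replicate_succ, ops, ih, op, czOp, Matrix.diagonal_mul_diagonal]
    congr 1
    funext x
    rw [← AddChar.map_add_eq_mul]
    congr 1
    push_cast
    ring

theorem ops_flatMap_cz {ι : Type*} (a b : ι → V) (n : ι → ℕ) (l : List ι) :
    ops (l.flatMap fun j => List.replicate (n j) (cz (a j) (b j) : FanoutGate d V)) =
      Matrix.diagonal fun x =>
        ZMod.stdAddChar ((l.map fun j => (n j : ZMod d) * (x (a j) * x (b j))).sum) := by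
  induction l with
  | nil => simp [ops]
  | cons j l ih =>
    rw [List.flatMap_cons, ops_append, ih, ops_replicate_cz, Matrix.diagonal_mul_diagonal]
    congr 1
    funext x
    rw [← AddChar.map_add_eq_mul, List.map_cons, List.sum_cons, add_comm]

end FanoutGate

/-- The hypothesis says that `f` carries the dit of `i` to the wire `i'` and to no other wire, so a
gate on `i` can be carried out on `i'`. -/
theorem onQudit_mul_basisMap {W : Type*} [Fintype W] [DecidableEq W]
    {f : (V → ZMod d) → (W → ZMod d)} {i : V} {i' : W}
    (hf : ∀ x m, f (Function.update x i m) = Function.update (f x) i' m)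
    (A : Matrix (ZMod d) (ZMod d) ℂ) :
    onQudit i' A * basisMap f = basisMap f * onQudit i A := by
  have hfi : ∀ x, f x i' = x i := fun x => by
    have := congrFun (hf x (x i)) i'
    rw [Function.update_eq_self, Function.update_self] at this
    exact this
  ext w x
  rw [onQudit_mul_apply, mul_onQudit_apply, Finset.sum_eq_single (x i),
    Finset.sum_eq_single (w i')]
  · have : Function.update w i' (x i) = f x ↔ w = f (Function.update x i (w i')) := by
      rw [hf]
      constructor
      · intro h
        rw [← h]; simp
      · intro h
        rw [h, Function.update_idem, ← hfi x]
        simp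
    simp only [basisMap, Matrix.of_apply, this]
    split_ifs <;> simp
  · intro m _ hm
    have : w ≠ f (Function.update x i m) := fun h => hm <| by
      rw [h, hfi, Function.update_self]
    simp [basisMap, this]
  · simp
  · intro m _ hm
    have : Function.update w i' m ≠ f x := fun h => hm <| by
      rw [← hfi x, ← h, Function.update_self]
    simp [basisMap, this]
  · simp

/-! ## The simulating circuit -/

/-- The qudits of the simulating circuit: those of the pattern, a copy `(true, i, j)` of the outcome
of `j` for the commands on `i`, and a copy `(false, i, j)` of `i` that is paired with the former. -/
abbrev Wire (V : Type*) := V ⊕ Bool × V × V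

namespace PatternCommand

/-- The copies of the qudit `i` needed for a command that reads the outcomes in `T`. -/
def quditCopies (i : V) (T : Finset V) : Finset (Wire V) :=
  T.image fun j => Sum.inr (false, i, j)

/-- The copies of the outcome of `i` for the commands on the qudits in `S`. -/
def outcomeCopies (S : Finset V) (i : V) : Finset (Wire V) :=
  S.image fun k => Sum.inr (true, k, i)

/-- The controlled-`Z` gates between the copies of `i` and of the outcomes in `s`. -/
noncomputable def phaseGates (i : V) (s : DitSignal d V) : List (FanoutGate d (Wire V)) :=
  s.support.toList.flatMap fun j =>
    List.replicate (s j).val (.cz (Sum.inr (false, i, j)) (Sum.inr (true, i, j)))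

/-- Gates for the coherent `Z_i^s`. -/
noncomputable def signalZGates (i : V) (s : DitSignal d V) : List (FanoutGate d (Wire V)) :=
  .fanout (Sum.inl i) (quditCopies i s.support) ::
    (phaseGates i s ++
      List.replicate (d - 1) (.fanout (Sum.inl i) (quditCopies i s.support)))

/-- Gates for the coherent `X_i^s`. -/
noncomputable def signalXGates (i : V) (s : DitSignal d V) : List (FanoutGate d (Wire V)) :=
  .local1 (Sum.inl i) 0 ::
    (signalZGates i s ++ List.replicate 3 (.local1 (Sum.inl i) 0))

/-- Gates for a command whose outcome may be needed for the commands on the qudits in `S`. -/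
noncomputable def gates (S : Finset V) : PatternCommand d V → List (FanoutGate d (Wire V))
  | entangle i j => [.cz (Sum.inl i) (Sum.inl j)]
  | correctX i s => signalXGates i s
  | correctZ i s => signalZGates i s
  | measure i θ s t => signalZGates i t ++ (signalXGates i s ++
      [.local1 (Sum.inl i) θ, .fanout (Sum.inl i) (outcomeCopies S i)])

/-- The basis state of the simulating circuit that represents the basis state `x` after the
measurement of the qudits in `D`. -/
def withCopies (S D : Finset V) (x : V → ZMod d) : Wire V → ZMod d :=
  Sum.elim x fun p => if p.1 = true ∧ p.2.1 ∈ S ∧ p.2.2 ∈ D then x p.2.2 else 0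

/-- Once `i` is measured, a change of its dit would have to reach its copies as well. Local gates
can therefore be lifted only while `i ∉ D`. -/
theorem withCopies_update {S D : Finset V} {i : V} (hi : i ∉ D) (x : V → ZMod d) (m : ZMod d) :
    withCopies S D (Function.update x i m) =
      Function.update (withCopies S D x) (Sum.inl i) m := by
  funext k
  rcases k with k | ⟨b, k, l⟩
  · by_cases h : k = i
    · subst h; simp [withCopies]
    · simp [withCopies, h]
  · simp only [withCopies, Sum.elim_inr, ne_eq, reduceCtorEq, not_false_eq_true,
      Function.update_of_ne]
    split_ifs with h
    · rw [Function.update_of_ne (fun h' => hi (by rw [← h']; exact h.2.2))]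
    · rfl

/-! ### Intertwining of the gates with the encoding `withCopies` -/

theorem ops_phaseGates (i : V) (s : DitSignal d V) :
    FanoutGate.ops (phaseGates i s) = Matrix.diagonal fun w => ZMod.stdAddChar
      (∑ j ∈ s.support, s j * (w (Sum.inr (false, i, j)) * w (Sum.inr (true, i, j)))) := by
  rw [phaseGates, FanoutGate.ops_flatMap_cz]
  congr 1
  funext w
  rw [Finset.sum_map_toList]
  simp

/-- Copy, apply phases, erase. The wires `(false, i, j)` start at `0` and receive `x_i`; the pair
with `(true, i, j)`, which holds `x_j` because `i ∈ S` and `j ∈ D`, contributes `ω^(s_j x_i x_j)`.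
-/
theorem ops_signalZGates {S D : Finset V} {i : V} {s : DitSignal d V} (hi : i ∈ S)
    (hs : s.support ⊆ D) :
    FanoutGate.ops (signalZGates i s) * basisMap (withCopies (d := d) S D) =
      basisMap (withCopies (d := d) S D) * signalZOp i s := by
  have hc : (Sum.inl i : Wire V) ∉ quditCopies i s.support := by simp [quditCopies]
  set φ := FanoutGate.fanoutMap (d := d) (Sum.inl i) (quditCopies i s.support) with hφ
  have hop : (FanoutGate.fanout (Sum.inl i) (quditCopies i s.support) :
      FanoutGate d (Wire V)).op = basisMap φ := rfl
  have hid : φ^[d - 1] ∘ φ = id := by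
    rw [← Function.iterate_succ, Nat.succ_eq_add_one, Nat.sub_add_cancel (NeZero.pos d)]
    funext y
    rw [FanoutGate.fanoutMap_iterate hc]
    simp
  rw [signalZGates, FanoutGate.ops, FanoutGate.ops_append, FanoutGate.ops_replicate_fanout,
    ops_phaseGates, hop, Matrix.mul_assoc, basisMap_mul_basisMap, Matrix.mul_assoc,
    diagonal_mul_basisMap, ← Matrix.mul_assoc, basisMap_mul_basisMap, ← Function.comp_assoc, hid,
    Function.id_comp, signalZOp]
  congr 2
  funext x
  simp only [Function.comp_apply]
  congr 1
  rw [DitSignal.value, Finset.sum_mul, ← Finset.sum_subset (Finset.subset_univ s.support)]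
  · refine Finset.sum_congr rfl fun j hj => ?_
    simp only [hφ, FanoutGate.fanoutMap, quditCopies, withCopies, Finset.mem_image,
      Sum.inr.injEq, Prod.mk.injEq, true_and, exists_eq_right, hj, hi, hs hj, and_self, if_true,
      Sum.elim_inl, Sum.elim_inr, Bool.false_eq_true, false_and, and_false, exists_false, if_false,
      zero_add]
    ring
  · intro j _ hj
    have : s j = 0 := by simpa [DitSignal.support] using hj
    simp [this]

theorem ops_signalXGates {S D : Finset V} {i : V} {s : DitSignal d V} (hi : i ∈ S) (hiD : i ∉ D)
    (hs : s.support ⊆ D) :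
    FanoutGate.ops (signalXGates i s) * basisMap (withCopies (d := d) S D) =
      basisMap (withCopies (d := d) S D) * signalXOp i s := by
  have hF := onQudit_mul_basisMap (fun x m => withCopies_update (S := S) hiD x m) (fourierGate d)
  have hF3 := onQudit_mul_basisMap (fun x m => withCopies_update (S := S) hiD x m)
    (fourierGate d * fourierGate d * fourierGate d)
  have h3 : FanoutGate.ops (List.replicate 3 (.local1 (Sum.inl i) 0 : FanoutGate d (Wire V))) =
      onQudit (Sum.inl i) (fourierGate d * fourierGate d * fourierGate d) := by
    simp only [List.replicate, FanoutGate.ops, FanoutGate.op, vGate_zero, Matrix.one_mul,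
      onQudit_mul_onQudit]
  rw [signalXGates, FanoutGate.ops, FanoutGate.ops_append, h3, FanoutGate.op, vGate_zero,
    Matrix.mul_assoc, hF, ← Matrix.mul_assoc, Matrix.mul_assoc _ _ (basisMap _),
    ops_signalZGates hi hs, ← Matrix.mul_assoc, hF3, signalXOp]
  simp only [Matrix.mul_assoc]

/-- Since `i ∉ D`, the target wires hold `0`, and adding the dit of `i` makes them copies. -/
theorem fanoutMap_comp_withCopies {S D : Finset V} {i : V} (hiD : i ∉ D) :
    FanoutGate.fanoutMap (d := d) (Sum.inl i) (outcomeCopies S i) ∘ withCopies S D =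
      withCopies S (D ∪ {i}) := by
  funext x k
  rcases k with k | ⟨b, k, l⟩
  · simp [FanoutGate.fanoutMap, outcomeCopies, withCopies]
  · simp only [Function.comp_apply, FanoutGate.fanoutMap, outcomeCopies, withCopies,
      Finset.mem_image, Sum.inr.injEq, Prod.mk.injEq, Sum.elim_inl, Sum.elim_inr,
      Finset.mem_union, Finset.mem_singleton]
    by_cases hl : l = i
    · subst hl
      cases b <;> simp [hiD]
    · simp [hl, Ne.symm hl]

theorem ops_gates {S D : Finset V} {c : PatternCommand d V} (hS : c.qudits ⊆ S)
    (hD : Disjoint c.qudits D) (hr : c.reads ⊆ D) :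
    FanoutGate.ops (gates S c) * basisMap (withCopies (d := d) S D) =
      basisMap (withCopies (d := d) S (D ∪ c.measured)) * c.coherentOp := by
  cases c with
  | entangle i j =>
    simp only [gates, FanoutGate.ops, FanoutGate.op, Matrix.one_mul, measured,
      Finset.union_empty, coherentOp, czOp]
    rw [diagonal_mul_basisMap]
    rfl
  | correctX i s =>
    simp only [qudits, Finset.singleton_subset_iff, Finset.disjoint_singleton_left] at hS hD
    simp only [measured, Finset.union_empty]
    exact ops_signalXGates hS hD hr
  | correctZ i s =>
    simp only [qudits, Finset.singleton_subset_iff] at hS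
    simp only [measured, Finset.union_empty]
    exact ops_signalZGates hS hr
  | measure i θ s t =>
    simp only [qudits, Finset.singleton_subset_iff, Finset.disjoint_singleton_left] at hS hD
    simp only [reads, Finset.union_subset_iff] at hr
    have hv := onQudit_mul_basisMap (fun x m => withCopies_update (S := S) hD x m) (vGate θ)
    have hop : (FanoutGate.fanout (Sum.inl i) (outcomeCopies S i) : FanoutGate d (Wire V)).op =
      basisMap (FanoutGate.fanoutMap (Sum.inl i) (outcomeCopies S i)) := rfl
    rw [gates, FanoutGate.ops_append, FanoutGate.ops_append, Matrix.mul_assoc,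
      ops_signalZGates hS hr.2, ← Matrix.mul_assoc, Matrix.mul_assoc _ _ (basisMap _),
      ops_signalXGates hS hD hr.1]
    simp only [FanoutGate.ops, Matrix.one_mul, hop]
    rw [FanoutGate.op, ← Matrix.mul_assoc, Matrix.mul_assoc _ _ (basisMap _), hv,
      ← Matrix.mul_assoc, basisMap_mul_basisMap, fanoutMap_comp_withCopies hD, measured,
      coherentOp]
    simp only [Matrix.mul_assoc]

/-- The qudits measured by a sequence of commands. -/
def measuredQudits : List (PatternCommand d V) → Finset V
  | [] => ∅
  | c :: cs => c.measured ∪ measuredQudits cs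

theorem mem_measuredQudits {i : V} :
    ∀ {cs : List (PatternCommand d V)}, i ∈ measuredQudits cs ↔ ∃ c ∈ cs, i ∈ c.measured
  | [] => by simp [measuredQudits]
  | c :: cs => by simp [measuredQudits, mem_measuredQudits (cs := cs)]

theorem ops_flatMap_gates {S : Finset V} {cs : List (PatternCommand d V)} :
    ∀ {D : Finset V}, Runnable D cs → (∀ c ∈ cs, c.qudits ⊆ S) →
      FanoutGate.ops (cs.flatMap (gates S)) * basisMap (withCopies (d := d) S D) =
        basisMap (withCopies (d := d) S (D ∪ measuredQudits cs)) * coherentOps cs := by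
  induction cs with
  | nil =>
    intro D _ _
    simp [FanoutGate.ops, measuredQudits, coherentOps]
  | cons c cs ih =>
    intro D h hS
    obtain ⟨-, hq, hr, hrun⟩ := h
    rw [List.flatMap_cons, FanoutGate.ops_append, Matrix.mul_assoc,
      ops_gates (hS c (by simp)) hq hr, ← Matrix.mul_assoc,
      ih hrun fun c hc => hS c (by simp [hc]), measuredQudits, coherentOps, Finset.union_assoc,
      Matrix.mul_assoc]

end PatternCommand

/-! ## The copies in the output state -/

/-- The partial trace requires the copies in row and column to agree. A nonzero copy repeats the dit
of a qudit in `D`, which is not an output and is itself traced out, so this requirement is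
automatic. -/
theorem outputState_withCopies {O : Type*} [Fintype O] (out : O ↪ V) {S D : Finset V}
    (hD : ∀ o, out o ∉ D) (ρ : QuditOp d V) :
    outputState (out.trans Function.Embedding.inl)
      (basisMap (PatternCommand.withCopies (d := d) S D) * ρ *
        (basisMap (PatternCommand.withCopies (d := d) S D))ᴴ : QuditOp d (Wire V)) = outputState out ρ := by
  ext a b
  rw [outputState_eq_trace, outputState_eq_trace, Matrix.mul_assoc, Matrix.mul_assoc,
    Matrix.trace_mul_comm, Matrix.mul_assoc, basisMap_conjTranspose_mul_mul]
  congr 2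
  ext y x
  simp only [reducedEntry, Matrix.submatrix_apply, Matrix.of_apply, Function.Embedding.trans_apply,
    Function.Embedding.inl_apply]
  congr 1
  refine propext <| and_congr Iff.rfl <| and_congr Iff.rfl ⟨fun h k hk => ?_, fun h k hk => ?_⟩
  · refine h (Sum.inl k) ?_
    simpa using hk
  · rcases k with k | ⟨e, k, l⟩
    · refine h k ?_
      simpa using hk
    · simp only [PatternCommand.withCopies, Sum.elim_inr]
      split_ifs with hl
      · refine h l ?_
        simp only [Finset.mem_map, Finset.mem_univ, true_and, not_exists]
        rintro o rfl
        exact hD o hl.2.2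
      · rfl

/-! ## The initial state -/

variable {I : Type*} [Fintype I] [DecidableEq I]

/-- The map from input states to initial states in which every non-input qudit `k` is prepared in
the pure state `a k`. -/
def preparation (inp : I ↪ V) (a : V → ZMod d → ℂ) :
    Matrix (V → ZMod d) (I → ZMod d) ℂ :=
  Matrix.of fun x j => if (fun i => x (inp i)) = j then
    ∏ k ∈ Finset.univ \ Finset.univ.map inp, a k (x k) else 0

theorem initialState_eq (inp : I ↪ V) (a : ZMod d → ℂ) (ρ : QuditOp d I) :
    initialState inp a ρ =
      preparation inp (fun _ => a) * ρ * (preparation inp fun _ => a)ᴴ := by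
  ext x y
  simp only [initialState, preparation, Matrix.mul_apply, Matrix.conjTranspose_apply,
    Matrix.of_apply, ite_mul, zero_mul, Finset.sum_ite_eq, Finset.mem_univ, if_true, apply_ite star,
    star_zero, mul_ite, mul_zero]
  rw [Finset.prod_mul_distrib, star_prod]
  ring

theorem preparation_congr {inp : I ↪ V} {a b : V → ZMod d → ℂ}
    (h : ∀ k, k ∉ Set.range inp → a k = b k) : preparation inp a = preparation inp b := by
  ext x j
  simp only [preparation, Matrix.of_apply]
  congr 1
  refine Finset.prod_congr rfl fun k hk => ?_
  rw [h k (by simpa using hk)]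

theorem onQudit_mul_preparation {inp : I ↪ V} {k : V} (hk : k ∉ Set.range inp)
    (A : Matrix (ZMod d) (ZMod d) ℂ) (a : V → ZMod d → ℂ) :
    onQudit k A * preparation inp a = preparation inp (Function.update a k (A *ᵥ a k)) := by
  have hk' : k ∈ Finset.univ \ Finset.univ.map inp := by simpa using hk
  have hne : ∀ i, inp i ≠ k := fun i h => hk ⟨i, h⟩
  ext x j
  rw [onQudit_mul_apply]
  simp only [preparation, Matrix.of_apply, Function.update_of_ne (hne _)]
  split_ifs with h
  · rw [← Finset.mul_prod_erase _ _ hk', Function.update_self, Matrix.mulVec, dotProduct,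
      Finset.sum_mul]
    refine Finset.sum_congr rfl fun m _ => ?_
    rw [← Finset.mul_prod_erase _ _ hk', Function.update_self, mul_assoc]
    congr 2
    refine Finset.prod_congr rfl fun l hl => ?_
    have hl : l ≠ k := (Finset.mem_erase.1 hl).1
    rw [Function.update_of_ne hl, Function.update_of_ne hl]
  · simp

/-- The operator `A` on every qudit in a list. -/
noncomputable def onQudits (A : Matrix (ZMod d) (ZMod d) ℂ) : List V → QuditOp d V
  | [] => 1
  | k :: l => onQudits A l * onQudit k A

theorem onQudits_mul_preparation {inp : I ↪ V} (A : Matrix (ZMod d) (ZMod d) ℂ) (a₀ : ZMod d → ℂ)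
    {l : List V} : ∀ {a : V → ZMod d → ℂ}, l.Nodup → (∀ k ∈ l, k ∉ Set.range inp) →
      (∀ k ∈ l, a k = a₀) →
      onQudits A l * preparation inp a =
        preparation inp fun k => if k ∈ l then A *ᵥ a₀ else a k := by
  induction l with
  | nil =>
    intro a _ _ _
    simp [onQudits]
  | cons k l ih =>
    intro a hl hinp ha
    have hkl := (List.nodup_cons.1 hl).1
    rw [onQudits, Matrix.mul_assoc, onQudit_mul_preparation (hinp k (by simp)),
      ih (List.nodup_cons.1 hl).2 (fun k hk => hinp k (by simp [hk]))]
    · congr 1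
      funext m
      by_cases hm : m ∈ l
      · simp [hm]
      · by_cases hmk : m = k
        · subst hmk; simp [hm, ha]
        · simp [hm, hmk]
    · intro m hm
      rw [Function.update_of_ne (by rintro rfl; exact hkl hm), ha m (by simp [hm])]

theorem preparation_withCopies (inp : I ↪ V) (S : Finset V) :
    (preparation (inp.trans Function.Embedding.inl) (fun _ => Pi.single 0 1) :
      Matrix (Wire V → ZMod d) (I → ZMod d) ℂ) =
      basisMap (PatternCommand.withCopies (d := d) S ∅) *
        preparation (d := d) inp (fun _ => Pi.single 0 1) := by
  ext w j
  rw [Matrix.mul_apply]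
  simp only [basisMap, preparation, Matrix.of_apply, ite_mul, one_mul, zero_mul,
    Function.Embedding.trans_apply, Function.Embedding.inl_apply, Pi.single_apply,
    Finset.prod_ite_zero, Finset.prod_const_one]
  rw [Finset.sum_eq_single (w ∘ Sum.inl)]
  · have hw : w = PatternCommand.withCopies S ∅ (w ∘ Sum.inl) ↔ ∀ p, w (Sum.inr p) = 0 := by
      constructor
      · intro h p
        rw [h]; simp [PatternCommand.withCopies]
      · intro h
        funext k
        rcases k with k | p
        · simp [PatternCommand.withCopies]
        · simp [PatternCommand.withCopies, h p]
    have hall : (∀ k ∈ Finset.univ \ Finset.univ.map (inp.trans Function.Embedding.inl),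
        w k = 0) ↔ (∀ p, w (Sum.inr p) = 0) ∧
          ∀ k ∈ Finset.univ \ Finset.univ.map inp, (w ∘ Sum.inl) k = 0 := by
      simp [Sum.forall, and_comm]
    by_cases h1 : ∀ p, w (Sum.inr p) = 0
    · rw [if_pos (hw.2 h1)]
      simp only [hall, h1, implies_true, true_and, Function.comp_apply]
    · rw [if_neg fun h => h1 (hw.1 h)]
      simp only [hall, h1, false_and, if_false, ite_self]
  · intro x _ hx
    rw [if_neg]
    rintro rfl
    exact hx (by funext k; simp [PatternCommand.withCopies])
  · simp

theorem ops_map_local1 (l : List V) (θ : ZMod d → ℝ) (S : Finset V) :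
    FanoutGate.ops (l.map fun k => (.local1 (Sum.inl k) θ : FanoutGate d (Wire V))) *
      basisMap (PatternCommand.withCopies (d := d) S ∅) =
        basisMap (PatternCommand.withCopies (d := d) S ∅) * onQudits (vGate θ) l := by
  induction l with
  | nil => simp [FanoutGate.ops, onQudits]
  | cons k l ih =>
    have hv := onQudit_mul_basisMap
      (fun x m => PatternCommand.withCopies_update (S := S) (Finset.notMem_empty k) x m) (vGate θ)
    rw [List.map_cons, FanoutGate.ops, FanoutGate.op, Matrix.mul_assoc, hv, ← Matrix.mul_assoc, ih,
      onQudits, Matrix.mul_assoc]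

end Circuit

/-! ## Longest paths -/

section Paths

variable {α β : Type*} {dep : α → α → Prop}

theorem longestPath_le_iff {l : List α} {n : ℕ} :
    longestPath dep l ≤ n ↔ ∀ p : List α, p.Sublist l → p.IsChain dep → p.length ≤ n := by
  constructor
  · intro h p hp hc
    exact (length_le_longestPath hp hc).trans h
  · intro h
    obtain ⟨p, hp, hc, hl⟩ := exists_longestPath dep l
    exact hl ▸ h p hp hc

theorem longestPath_append_le (l₁ l₂ : List α) :
    longestPath dep (l₁ ++ l₂) ≤ longestPath dep l₁ + longestPath dep l₂ := by
  rw [longestPath_le_iff]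
  intro p hp hc
  obtain ⟨p₁, p₂, rfl, h₁, h₂⟩ := List.sublist_append_iff.1 hp
  rw [List.length_append]
  exact add_le_add (length_le_longestPath h₁ (hc.left_of_append))
    (length_le_longestPath h₂ (hc.right_of_append))

theorem longestPath_le_length (l : List α) : longestPath dep l ≤ l.length :=
  longestPath_le_iff.2 fun _ hp _ => hp.length_le

theorem longestPath_cons_le (a : α) (l : List α) :
    longestPath dep (a :: l) ≤ 1 + longestPath dep l :=
  (longestPath_append_le [a] l).trans (Nat.add_le_add_right (longestPath_le_length [a]) _)

theorem longestPath_le_one {l : List α} (h : l.Pairwise fun a b => ¬ dep a b) :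
    longestPath dep l ≤ 1 := by
  rw [longestPath_le_iff]
  intro p hp hc
  match p, hp, hc with
  | [], _, _ => simp
  | [_], _, _ => simp
  | a :: b :: _, hp, hc =>
    have h1 := List.rel_of_pairwise_cons (h.sublist hp) (a' := b) (by simp)
    exact absurd (List.isChain_cons_cons.1 hc).1 h1

theorem one_le_longestPath {l : List α} (h : l ≠ []) : 1 ≤ longestPath dep l := by
  obtain ⟨a, l, rfl⟩ := List.exists_cons_of_ne_nil h
  exact length_le_longestPath (p := [a]) (by simp) (List.isChain_singleton a)

/-- The blocks `f a` that a path meets form a path of `dep`: the last element in one block and the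
first in the next are related by `dep'`, so the blocks cannot be independent. Each block contributes
at most `K` elements. The clause on heads records which block the path starts in, as the induction
needs in order to attach an earlier block. -/
theorem exists_path_of_flatMap {dep' : β → β → Prop} {f : α → List β} {K : ℕ} :
    ∀ {l : List α}, (∀ a ∈ l, longestPath dep' (f a) ≤ K) →
      l.Pairwise (fun a b => ¬ dep a b → ∀ x ∈ f a, ∀ y ∈ f b, ¬ dep' x y) →
      ∀ {p : List β}, p.Sublist (l.flatMap f) → p.IsChain dep' →
      ∃ q : List α, q.Sublist l ∧ q.IsChain dep ∧ p.length ≤ K * q.length ∧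
        ∀ y ∈ p.head?, ∃ b ∈ q.head?, y ∈ f b
  | [], _, _, p, hp, _ => by
    have : p = [] := by simpa using hp
    subst this
    exact ⟨[], by simp⟩
  | a :: l, hK, hl, p, hp, hc => by
    rw [List.flatMap_cons] at hp
    obtain ⟨p₁, p₂, rfl, h₁, h₂⟩ := List.sublist_append_iff.1 hp
    obtain ⟨q, hq, hqc, hlen, hhead⟩ := exists_path_of_flatMap
      (fun a ha => hK a (by simp [ha])) hl.of_cons h₂ hc.right_of_append
    have hlen₁ : p₁.length ≤ K :=
      (length_le_longestPath h₁ hc.left_of_append).trans (hK a (by simp))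
    -- If the path misses the first block, `q` is kept. Otherwise `a` is put in front of it, or
    -- stands alone if nothing follows.
    rcases List.eq_nil_or_concat p₁ with rfl | ⟨p₀, x, rfl⟩
    · exact ⟨q, hq.trans (List.sublist_cons_self _ _), hqc, by simpa using hlen, by simpa using hhead⟩
    · have hmem : ∀ z ∈ (p₀.concat x ++ p₂).head?, z ∈ f a := by
        intro z hz
        refine h₁.subset ?_
        rw [List.head?_append_of_ne_nil _ (by simp)] at hz
        exact List.mem_of_mem_head? hz
      rcases p₂ with _ | ⟨y, p₂⟩
      · refine ⟨[a], by simp, List.isChain_singleton a, ?_, fun z hz => ⟨a, by simp, hmem z hz⟩⟩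
        simpa using hlen₁
      · refine ⟨a :: q, hq.cons_cons a, ?_, ?_, fun z hz => ⟨a, by simp, hmem z hz⟩⟩
        · rw [List.isChain_cons]
          refine ⟨fun b hb => ?_, hqc⟩
          obtain ⟨b', hb', hy⟩ := hhead y (by simp)
          obtain rfl : b' = b := by
            rw [Option.mem_def] at hb hb'
            exact Option.some.inj (hb'.symm.trans hb)
          by_contra hab
          refine List.rel_of_pairwise_cons hl (hq.subset (List.mem_of_mem_head? hb)) hab x
            (h₁.subset (by simp)) y hy ?_
          rw [List.concat_eq_append, List.append_assoc] at hc
          exact (List.isChain_cons_cons.1 hc.right_of_append).1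
        · rw [List.length_append, List.length_cons (as := q), mul_add, mul_one]
          omega

theorem longestPath_flatMap_le {dep' : β → β → Prop} {f : α → List β} {K : ℕ} {l : List α}
    (hK : ∀ a ∈ l, longestPath dep' (f a) ≤ K)
    (hl : l.Pairwise fun a b => ¬ dep a b → ∀ x ∈ f a, ∀ y ∈ f b, ¬ dep' x y) :
    longestPath dep' (l.flatMap f) ≤ K * longestPath dep l := by
  rw [longestPath_le_iff]
  intro p hp hc
  obtain ⟨q, hq, hqc, hlen, -⟩ := exists_path_of_flatMap hK hl hp hc
  exact hlen.trans (Nat.mul_le_mul_left _ (length_le_longestPath hq hqc))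

end Paths

/-! ## Depth and size of the simulating circuit -/

section Bounds

variable {d : ℕ} [NeZero d] {V : Type*} [Fintype V] [DecidableEq V]

namespace PatternCommand

theorem longestPath_phaseGates_le (i : V) (s : DitSignal d V) :
    longestPath FanoutGate.DependsOn (phaseGates i s) ≤ d := by
  -- The gate groups for distinct `j` act on disjoint pairs of wires. They are thus blocks over an
  -- index list with no dependence at all, each of at most `d` gates.
  have h1 : longestPath (fun _ _ : V => False) s.support.toList ≤ 1 :=
    longestPath_le_one (List.pairwise_of_forall fun _ _ => id)
  refine (longestPath_flatMap_le (dep := fun _ _ : V => False) (K := d) ?_ ?_).trans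
    ((Nat.mul_le_mul_left d h1).trans_eq (mul_one d))
  · intro j _
    refine (longestPath_le_length _).trans ?_
    rw [List.length_replicate]
    exact (ZMod.val_lt _).le
  · refine (Finset.nodup_toList _).imp ?_
    intro j k hjk _ x hx y hy
    rw [List.eq_of_mem_replicate hx, List.eq_of_mem_replicate hy]
    simp [FanoutGate.DependsOn, FanoutGate.qudits, hjk.symm]

theorem longestPath_signalZGates_le (i : V) (s : DitSignal d V) :
    longestPath FanoutGate.DependsOn (signalZGates i s) ≤ 2 * d := by
  have h1 := longestPath_phaseGates_le i s
  have h2 := longestPath_le_length (dep := FanoutGate.DependsOn)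
    (List.replicate (d - 1) (.fanout (Sum.inl i) (quditCopies i s.support) : FanoutGate d (Wire V)))
  rw [List.length_replicate] at h2
  have h3 := longestPath_append_le (dep := FanoutGate.DependsOn) (phaseGates i s)
    (List.replicate (d - 1) (.fanout (Sum.inl i) (quditCopies i s.support) : FanoutGate d (Wire V)))
  have h4 := longestPath_cons_le (dep := FanoutGate.DependsOn)
    (.fanout (Sum.inl i) (quditCopies i s.support) : FanoutGate d (Wire V))
    (phaseGates i s ++ List.replicate (d - 1) (.fanout (Sum.inl i) (quditCopies i s.support)))
  have := NeZero.pos d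
  rw [signalZGates]
  omega

theorem longestPath_signalXGates_le (i : V) (s : DitSignal d V) :
    longestPath FanoutGate.DependsOn (signalXGates i s) ≤ 2 * d + 4 := by
  have h1 := longestPath_signalZGates_le i s
  have h2 := longestPath_le_length (dep := FanoutGate.DependsOn)
    (List.replicate 3 (.local1 (Sum.inl i) 0 : FanoutGate d (Wire V)))
  rw [List.length_replicate] at h2
  have h3 := longestPath_append_le (dep := FanoutGate.DependsOn) (signalZGates i s)
    (List.replicate 3 (.local1 (Sum.inl i) 0 : FanoutGate d (Wire V)))
  have h4 := longestPath_cons_le (dep := FanoutGate.DependsOn)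
    (.local1 (Sum.inl i) 0 : FanoutGate d (Wire V))
    (signalZGates i s ++ List.replicate 3 (.local1 (Sum.inl i) 0))
  rw [signalXGates]
  omega

/-- A measurement is the worst case: `2 d` for `Z^t`, `2 d + 4` for `X^s`, and two for the rotation
and the fan-out of the outcome. -/
theorem longestPath_gates_le (S : Finset V) (c : PatternCommand d V) :
    longestPath FanoutGate.DependsOn (gates S c) ≤ 4 * d + 6 := by
  cases c with
  | entangle i j =>
    have := longestPath_le_length (dep := FanoutGate.DependsOn) (gates (d := d) S (entangle i j))
    simp only [gates, List.length_singleton] at this ⊢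
    omega
  | correctX i s => exact (longestPath_signalXGates_le i s).trans (by omega)
  | correctZ i s => exact (longestPath_signalZGates_le i s).trans (by omega)
  | measure i θ s t =>
    have h1 := longestPath_signalZGates_le i t
    have h2 := longestPath_signalXGates_le i s
    have h3 := longestPath_le_length (dep := FanoutGate.DependsOn)
      ([.local1 (Sum.inl i) θ, .fanout (Sum.inl i) (outcomeCopies S i)] :
        List (FanoutGate d (Wire V)))
    have h4 := longestPath_append_le (dep := FanoutGate.DependsOn) (signalXGates i s)
      [.local1 (Sum.inl i) θ, .fanout (Sum.inl i) (outcomeCopies S i)]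
    have h5 := longestPath_append_le (dep := FanoutGate.DependsOn) (signalZGates i t)
      (signalXGates i s ++ [.local1 (Sum.inl i) θ, .fanout (Sum.inl i) (outcomeCopies S i)])
    simp only [List.length_cons, List.length_nil] at h3
    rw [gates]
    omega

/-- The qudits of the simulating circuit on which the gates for a command act. -/
def Touches (c : PatternCommand d V) : Wire V → Prop
  | Sum.inl i => i ∈ c.qudits
  | Sum.inr (false, i, _) => i ∈ c.qudits
  | Sum.inr (true, i, j) => i ∈ c.qudits ∧ j ∈ c.reads ∨ j ∈ c.measured

theorem touches_of_mem_signalZGates {c : PatternCommand d V} {i : V} {s : DitSignal d V}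
    (hi : i ∈ c.qudits) (hs : s.support ⊆ c.reads) :
    ∀ g ∈ signalZGates i s, ∀ k ∈ g.qudits, c.Touches k := by
  have hf : ∀ k ∈ (FanoutGate.fanout (Sum.inl i) (quditCopies i s.support) :
      FanoutGate d (Wire V)).qudits, c.Touches k := by
    intro k hk
    simp only [FanoutGate.qudits, quditCopies, Finset.mem_insert, Finset.mem_image] at hk
    rcases hk with rfl | ⟨j, _, rfl⟩ <;> exact hi
  intro g hg
  simp only [signalZGates, List.mem_cons, List.mem_append, phaseGates, List.mem_flatMap,
    Finset.mem_toList] at hg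
  rcases hg with rfl | ⟨j, hj, hg⟩ | hg
  · exact hf
  · rw [List.eq_of_mem_replicate hg]
    intro k hk
    simp only [FanoutGate.qudits, Finset.mem_insert, Finset.mem_singleton] at hk
    rcases hk with rfl | rfl
    · exact hi
    · exact Or.inl ⟨hi, hs hj⟩
  · rw [List.eq_of_mem_replicate hg]
    exact hf

theorem touches_of_mem_signalXGates {c : PatternCommand d V} {i : V} {s : DitSignal d V}
    (hi : i ∈ c.qudits) (hs : s.support ⊆ c.reads) :
    ∀ g ∈ signalXGates i s, ∀ k ∈ g.qudits, c.Touches k := by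
  have hl : ∀ k ∈ (FanoutGate.local1 (Sum.inl i) 0 : FanoutGate d (Wire V)).qudits,
      c.Touches k := by
    intro k hk
    rw [FanoutGate.qudits, Finset.mem_singleton] at hk
    subst hk
    exact hi
  intro g hg
  simp only [signalXGates, List.mem_cons, List.mem_append] at hg
  rcases hg with rfl | hg | hg
  · exact hl
  · exact touches_of_mem_signalZGates hi hs g hg
  · rw [List.eq_of_mem_replicate hg]
    exact hl

theorem touches_of_mem_gates {S : Finset V} {c : PatternCommand d V} :
    ∀ g ∈ gates S c, ∀ k ∈ g.qudits, c.Touches k := by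
  cases c with
  | entangle i j =>
    intro g hg k hk
    simp only [gates, List.mem_singleton] at hg
    subst hg
    simp only [FanoutGate.qudits, Finset.mem_insert, Finset.mem_singleton] at hk
    rcases hk with rfl | rfl <;> simp [Touches, qudits]
  | correctX i s => exact touches_of_mem_signalXGates (by simp [qudits]) subset_rfl
  | correctZ i s => exact touches_of_mem_signalZGates (by simp [qudits]) subset_rfl
  | measure i θ s t =>
    intro g hg
    simp only [gates, List.mem_cons, List.mem_append, List.not_mem_nil, or_false] at hg
    rcases hg with hg | hg | rfl | rfl
    · exact touches_of_mem_signalZGates (by simp [qudits]) Finset.subset_union_right g hg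
    · exact touches_of_mem_signalXGates (by simp [qudits]) Finset.subset_union_left g hg
    · intro k hk
      rw [FanoutGate.qudits, Finset.mem_singleton] at hk
      subst hk
      simp [Touches, qudits]
    · intro k hk
      simp only [FanoutGate.qudits, outcomeCopies, Finset.mem_insert, Finset.mem_image] at hk
      rcases hk with rfl | ⟨j, _, rfl⟩ <;> simp [Touches, qudits, measured]

theorem measured_subset_qudits (c : PatternCommand d V) : c.measured ⊆ c.qudits := by
  cases c <;> simp [measured, qudits]

/-- The delicate wires are the copies `(true, i, j)`, touched by readers of `j` that act on `i` and
by the measurement of `j`. Two readers on different qudits use different copies; a measurement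
followed by a reader is a dependence; a reader followed by the measurement is excluded by `hr`. -/
theorem not_touches_of_not_dependsOn {a b : PatternCommand d V} (hab : ¬ DependsOn a b)
    (hr : Disjoint a.reads b.measured) (k : Wire V) (ha : a.Touches k) : ¬ b.Touches k := by
  simp only [DependsOn, not_or, not_not] at hab
  obtain ⟨hq, hm⟩ := hab
  intro hb
  rcases k with i | ⟨_ | _, i, j⟩
  · exact Finset.disjoint_left.1 hq ha hb
  · exact Finset.disjoint_left.1 hq ha hb
  · rcases ha with ⟨ha, ha'⟩ | ha <;> rcases hb with ⟨hb, hb'⟩ | hb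
    · exact Finset.disjoint_left.1 hq ha hb
    · exact Finset.disjoint_left.1 hr ha' hb
    · exact Finset.disjoint_left.1 hm ha hb'
    · exact Finset.disjoint_left.1 hq (measured_subset_qudits a ha) (measured_subset_qudits b hb)

/-- An outcome that is read has already been obtained, and no later command can measure that qudit
again. -/
theorem pairwise_disjoint_of_runnable {cs : List (PatternCommand d V)} :
    ∀ {D : Finset V}, Runnable D cs → cs.Pairwise fun a b => Disjoint a.reads b.measured := by
  induction cs with
  | nil => intro D _; exact List.Pairwise.nil
  | cons c cs ih =>
    intro D h
    refine List.Pairwise.cons (fun b hb => ?_) (ih h.2.2.2)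
    rw [Finset.disjoint_left]
    intro i hi hi'
    exact not_mem_qudits_of_runnable (Finset.mem_union_left _ (h.2.2.1 hi)) h.2.2.2 b hb
      (measured_subset_qudits b hi')

theorem longestPath_flatMap_gates_le {S D : Finset V} {cs : List (PatternCommand d V)}
    (h : Runnable D cs) :
    longestPath FanoutGate.DependsOn (cs.flatMap (gates S)) ≤
      (4 * d + 6) * longestPath DependsOn cs := by
  refine longestPath_flatMap_le (fun c _ => longestPath_gates_le S c)
    ((pairwise_disjoint_of_runnable h).imp ?_)
  intro a b hr hab x hx y hy hxy
  refine hxy (Finset.disjoint_left.2 fun k hk hk' => ?_)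
  exact not_touches_of_not_dependsOn hab hr k (touches_of_mem_gates x hx k hk)
    (touches_of_mem_gates y hy k hk')

/-! ### Size -/

/-- The sum over a sequence of gates of the number of qudits on which they act. -/
def gateSize {W : Type*} [Fintype W] [DecidableEq W] (l : List (FanoutGate d W)) : ℕ :=
  (l.map fun g => g.qudits.card).sum

theorem gateSize_append {W : Type*} [Fintype W] [DecidableEq W] (l₁ l₂ : List (FanoutGate d W)) :
    gateSize (l₁ ++ l₂) = gateSize l₁ + gateSize l₂ := by
  simp [gateSize]

theorem gateSize_cons {W : Type*} [Fintype W] [DecidableEq W] (g : FanoutGate d W)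
    (l : List (FanoutGate d W)) : gateSize (g :: l) = g.qudits.card + gateSize l := by
  simp [gateSize]

theorem gateSize_replicate {W : Type*} [Fintype W] [DecidableEq W] (g : FanoutGate d W) (n : ℕ) :
    gateSize (List.replicate n g) = n * g.qudits.card := by
  simp [gateSize]

theorem gateSize_flatMap_le {ι W : Type*} [Fintype W] [DecidableEq W] {l : List ι}
    {f : ι → List (FanoutGate d W)} {K : ℕ} (h : ∀ j ∈ l, gateSize (f j) ≤ K) :
    gateSize (l.flatMap f) ≤ l.length * K := by
  induction l with
  | nil => simp [gateSize]
  | cons j l ih =>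
    rw [List.flatMap_cons, gateSize_append, List.length_cons, add_mul, one_mul, add_comm]
    exact add_le_add (ih fun k hk => h k (by simp [hk])) (h j (by simp))

theorem gateSize_phaseGates_le (i : V) (s : DitSignal d V) :
    gateSize (phaseGates i s) ≤ s.support.card * (d * 2) := by
  rw [← Finset.length_toList]
  refine gateSize_flatMap_le fun j _ => ?_
  rw [gateSize_replicate]
  exact Nat.mul_le_mul (ZMod.val_lt _).le Finset.card_le_two

theorem card_qudits_fanout_quditCopies_le (i : V) (T : Finset V) :
    (FanoutGate.fanout (Sum.inl i) (quditCopies i T) : FanoutGate d (Wire V)).qudits.card ≤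
      T.card + 1 :=
  (Finset.card_insert_le _ _).trans (Nat.add_le_add_right Finset.card_image_le 1)

theorem gateSize_signalZGates_le {i : V} {s : DitSignal d V} {n : ℕ} (hn : s.support.card ≤ n) :
    gateSize (signalZGates i s) ≤ 3 * d * (n + 1) := by
  have h1 := gateSize_phaseGates_le i s
  have h2 := (card_qudits_fanout_quditCopies_le (d := d) i s.support).trans
    (Nat.add_le_add_right hn 1)
  have h3 : s.support.card * (d * 2) ≤ (n + 1) * (d * 2) :=
    Nat.mul_le_mul_right _ (hn.trans n.le_succ)
  have h4 := Nat.mul_le_mul_left (d - 1) h2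
  -- The count is `d` fan-outs of at most `n + 1` qudits and at most `n d` gates on two qudits; `d =
  -- e + 1` removes the truncated subtraction.
  obtain ⟨e, rfl⟩ : ∃ e, d = e + 1 := ⟨d - 1, (Nat.sub_add_cancel (NeZero.pos d)).symm⟩
  rw [signalZGates, gateSize_cons, gateSize_append, gateSize_replicate]
  rw [Nat.add_sub_cancel] at h4 ⊢
  nlinarith

theorem gateSize_signalXGates_le {i : V} {s : DitSignal d V} {n : ℕ} (hn : s.support.card ≤ n) :
    gateSize (signalXGates i s) ≤ 3 * d * (n + 1) + 4 := by
  have h1 := gateSize_signalZGates_le (i := i) hn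
  have h2 : (FanoutGate.local1 (Sum.inl i) 0 : FanoutGate d (Wire V)).qudits.card = 1 :=
    Finset.card_singleton _
  rw [signalXGates, gateSize_cons, gateSize_append, gateSize_replicate, h2]
  omega

theorem gateSize_gates_le {S : Finset V} {c : PatternCommand d V} {n : ℕ} (hS : S.card ≤ n)
    (hr : c.reads.card ≤ n) : gateSize (gates S c) ≤ (6 * d + 6) * (n + 1) := by
  have hexp : (6 * d + 6) * (n + 1) = 3 * d * (n + 1) + 3 * d * (n + 1) + 6 * n + 6 := by ring
  rw [hexp]
  cases c with
  | entangle i j =>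
    have h2 : (FanoutGate.cz (Sum.inl i) (Sum.inl j) : FanoutGate d (Wire V)).qudits.card ≤ 2 :=
      Finset.card_le_two
    simp only [gates, gateSize, List.map_cons, List.map_nil, List.sum_cons, List.sum_nil]
    omega
  | correctX i s =>
    have := gateSize_signalXGates_le (i := i) hr
    rw [gates]
    omega
  | correctZ i s =>
    have := gateSize_signalZGates_le (i := i) hr
    rw [gates]
    omega
  | measure i θ s t =>
    have h1 := gateSize_signalXGates_le (i := i) (s := s)
      ((Finset.card_le_card Finset.subset_union_left).trans hr)
    have h2 := gateSize_signalZGates_le (i := i) (s := t)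
      ((Finset.card_le_card Finset.subset_union_right).trans hr)
    have h3 : (FanoutGate.local1 (Sum.inl i) θ : FanoutGate d (Wire V)).qudits.card = 1 :=
      Finset.card_singleton _
    have h4 : (FanoutGate.fanout (Sum.inl i) (outcomeCopies S i) :
        FanoutGate d (Wire V)).qudits.card ≤ n + 1 :=
      (Finset.card_insert_le _ _).trans
        (Nat.add_le_add_right (Finset.card_image_le.trans hS) 1)
    rw [gates, gateSize_append, gateSize_append, gateSize_cons, gateSize_cons, h3]
    simp only [gateSize, List.map_nil, List.sum_nil] at h1 h2 ⊢
    omega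

/-- The qudits on which a sequence of commands acts. -/
def usedQudits : List (PatternCommand d V) → Finset V
  | [] => ∅
  | c :: cs => c.qudits ∪ usedQudits cs

theorem mem_usedQudits {i : V} :
    ∀ {cs : List (PatternCommand d V)}, i ∈ usedQudits cs ↔ ∃ c ∈ cs, i ∈ c.qudits
  | [] => by simp [usedQudits]
  | c :: cs => by simp [usedQudits, mem_usedQudits (cs := cs)]

theorem card_usedQudits_le :
    ∀ cs : List (PatternCommand d V), (usedQudits cs).card ≤ (cs.map fun c => c.qudits.card).sum
  | [] => by simp [usedQudits]
  | c :: cs => by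
    rw [usedQudits, List.map_cons, List.sum_cons]
    exact (Finset.card_union_le _ _).trans (Nat.add_le_add_left (card_usedQudits_le cs) _)

theorem length_le_sum_card (cs : List (PatternCommand d V)) :
    cs.length ≤ (cs.map fun c => c.qudits.card).sum := by
  induction cs with
  | nil => simp
  | cons c cs ih =>
    have : 1 ≤ c.qudits.card := by
      rw [Nat.one_le_iff_ne_zero, Finset.card_ne_zero]
      cases c <;> simp [qudits]
    rw [List.length_cons, List.map_cons, List.sum_cons]
    omega

/-- For `D = ∅` this bounds the length of every signal by the number of qudits used, and so by the
size of the pattern. -/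
theorem reads_subset_of_runnable {cs : List (PatternCommand d V)} :
    ∀ {D : Finset V}, Runnable D cs → ∀ c ∈ cs, c.reads ⊆ D ∪ usedQudits cs := by
  induction cs with
  | nil => simp
  | cons c cs ih =>
    intro D h c' hc'
    rcases List.mem_cons.1 hc' with rfl | hc'
    · exact h.2.2.1.trans Finset.subset_union_left
    · refine (ih h.2.2.2 c' hc').trans ?_
      rw [usedQudits, Finset.union_assoc]
      exact Finset.union_subset_union_right
        (Finset.union_subset_union_left (measured_subset_qudits c))

/-! ### Validity of the gates of the simulation -/

theorem valid_of_mem_gates {S : Finset V} {c : PatternCommand d V} (hc : c.Valid) :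
    ∀ g ∈ gates S c, g.Valid := by
  have hZ : ∀ (i : V) (s : DitSignal d V), ∀ g ∈ signalZGates i s, g.Valid := by
    intro i s g hg
    simp only [signalZGates, List.mem_cons, List.mem_append, phaseGates, List.mem_flatMap,
      Finset.mem_toList] at hg
    rcases hg with rfl | ⟨j, hj, hg⟩ | hg
    · simp [FanoutGate.Valid, quditCopies]
    · rw [List.eq_of_mem_replicate hg]
      simp [FanoutGate.Valid]
    · rw [List.eq_of_mem_replicate hg]
      simp [FanoutGate.Valid, quditCopies]
  have hX : ∀ (i : V) (s : DitSignal d V), ∀ g ∈ signalXGates i s, g.Valid := by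
    intro i s g hg
    simp only [signalXGates, List.mem_cons, List.mem_append] at hg
    rcases hg with rfl | hg | hg
    · trivial
    · exact hZ i s g hg
    · rw [List.eq_of_mem_replicate hg]
      trivial
  cases c with
  | entangle i j =>
    intro g hg
    simp only [gates, List.mem_singleton] at hg
    subst hg
    exact fun h => hc (Sum.inl_injective h)
  | correctX i s => exact hX i s
  | correctZ i s => exact hZ i s
  | measure i θ s t =>
    intro g hg
    simp only [gates, List.mem_cons, List.mem_append, List.not_mem_nil, or_false] at hg
    rcases hg with hg | hg | rfl | rfl
    · exact hZ i t g hg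
    · exact hX i s g hg
    · trivial
    · simp [FanoutGate.Valid, outcomeCopies]

theorem valid_of_runnable {cs : List (PatternCommand d V)} :
    ∀ {D : Finset V}, Runnable D cs → ∀ c ∈ cs, c.Valid := by
  induction cs with
  | nil => simp
  | cons c cs ih =>
    intro D h c' hc'
    rcases List.mem_cons.1 hc' with rfl | hc'
    · exact h.1
    · exact ih h.2.2.2 c' hc'

end PatternCommand

end Bounds

/-! ## Patterns that implement a unitary have no idle output -/

section Final

variable {d : ℕ} [NeZero d] {V I O : Type*} [Fintype V] [DecidableEq V] [Fintype I]
  [DecidableEq I] [Fintype O] [DecidableEq O]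

/-- Multiplication on one side only permutes the row index, so the shift of the output qudit passes
through the partial trace as a shift of `a`. -/
theorem outputState_pauliX_mul (out : O ↪ V) (o : O) (ρ : QuditOp d V) (s : ZMod d)
    (a b : O → ZMod d) :
    outputState out (onQudit (out o) (pauliXPow s) * ρ) (Function.update a o (a o + s)) b =
      outputState out ρ a b := by
  have hX : (onQudit (out o) (pauliXPow s) : QuditOp d V) =
      basisMap fun x => Function.update x (out o) (x (out o) + s) := by
    ext x y
    simp only [onQudit, pauliXPow, basisMap, Matrix.of_apply]
    rw [← ite_and]
    congr 1
    refine propext ⟨fun h => funext fun k => ?_, ?_⟩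
    · by_cases hk : k = out o
      · subst hk; simp [h.2]
      · simp [hk, h.1 k hk]
    · rintro rfl
      exact ⟨fun k hk => by simp [hk], by simp⟩
  rw [outputState_eq_trace, outputState_eq_trace, hX, Matrix.mul_assoc, Matrix.trace_mul_comm,
    Matrix.mul_assoc]
  congr 2
  ext y x
  have ha : (∀ o', Function.update x (out o) (x (out o) + s) (out o') =
      Function.update a o (a o + s) o') ↔ ∀ o', x (out o') = a o' := by
    refine forall_congr' fun o' => ?_
    by_cases ho : o' = o
    · subst ho; simp
    · rw [Function.update_of_ne (out.injective.ne ho), Function.update_of_ne ho]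
  have hk : (∀ k, k ∉ Finset.univ.map out →
      Function.update x (out o) (x (out o) + s) k = y k) ↔
      ∀ k, k ∉ Finset.univ.map out → x k = y k := by
    refine forall₂_congr fun k hk => ?_
    rw [Function.update_of_ne]
    rintro rfl
    exact hk (by simp)
  simp only [Matrix.mul_apply, basisMap, reducedEntry, Matrix.of_apply, mul_ite, mul_one, mul_zero,
    Finset.sum_ite_eq', Finset.mem_univ, if_true, ha, hk]

/-- An idle non-input output stays in `|+_0⟩`, which `X` fixes, so every output state is invariant
under a shift of its row index at `o`. A unitary attains all pure outputs, and `|0⟩⟨0|` is not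
invariant when `d ≥ 2`. -/
theorem noIdleOutput_of_implementsUnitary (hd : 2 ≤ d) (P : MeasurementPattern d V I O)
    {U : Matrix (O → ZMod d) (I → ZMod d) ℂ} (hU : ImplementsUnitary P.channel U) :
    P.NoIdleOutput := by
  intro o ho
  by_contra hidle
  push Not at hidle
  obtain ⟨-, hUU, himp⟩ := hU
  have : Fact (1 < d) := ⟨hd⟩
  have hplus : pauliXPow 1 *ᵥ (fun n : ZMod d => fourierGate d n 0) = fun n => fourierGate d n 0 := by
    funext n
    simp [Matrix.mulVec, dotProduct, pauliXPow, fourierGate, ← sub_eq_iff_eq_add]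
  have hprep := onQudit_mul_preparation ho (pauliXPow (1 : ZMod d))
    (fun _ n => fourierGate d n 0)
  rw [hplus, Function.update_eq_self] at hprep
  have hinv : ∀ ρ a b, P.channel ρ (Function.update a o (a o + 1)) b = P.channel ρ a b := by
    intro ρ a b
    have hrun := PatternCommand.run_onQudit_mul_mul (pauliXPow (1 : ZMod d)) 1 P.commands hidle 0
      (initialState P.inp (fun n => fourierGate d n 0) ρ)
    rw [onQudit_one, Matrix.mul_one, Matrix.mul_one, initialState_eq, ← Matrix.mul_assoc,
      ← Matrix.mul_assoc, hprep, ← initialState_eq] at hrun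
    rw [MeasurementPattern.channel, hrun, outputState_pauliX_mul, ← hrun]
  set e : (O → ZMod d) → ℂ := Pi.single 0 1 with he
  -- The input `U† |0⟩` is chosen so that the output is `|0⟩⟨0|`.
  have hch := himp (Uᴴ *ᵥ e)
  rw [Matrix.mulVec_mulVec, hUU, Matrix.one_mulVec] at hch
  have h := hinv (Matrix.vecMulVec (Uᴴ *ᵥ e) (star (Uᴴ *ᵥ e))) 0 0
  rw [hch] at h
  have h0 : Function.update (0 : O → ZMod d) o 1 ≠ 0 := fun h => one_ne_zero (α := ZMod d) <| by
    simpa using congrFun h o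
  simp [Matrix.vecMulVec_apply, he, h0] at h

/-! ## The simulation -/

namespace MeasurementPattern

/-- `|+_0⟩ = F |0⟩` on every non-input qudit. For those in no command, which by `hP` are not
outputs, the gate `F` passes through the run and is lost in the partial trace, so it is kept only on
the used qudits in `l₀`. -/
theorem channel_eq (P : MeasurementPattern d V I O) (hP : P.NoIdleOutput) (ρ : QuditOp d I) :
    P.channel ρ = outputState P.out (PatternCommand.coherentOps P.commands *
      (onQudits (fourierGate d)
        (PatternCommand.usedQudits P.commands \ Finset.univ.map P.inp).toList *
        preparation (d := d) P.inp (fun _ => Pi.single 0 1) * ρ *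
        (onQudits (fourierGate d)
          (PatternCommand.usedQudits P.commands \ Finset.univ.map P.inp).toList *
          preparation (d := d) P.inp (fun _ => Pi.single 0 1))ᴴ) *
      (PatternCommand.coherentOps P.commands)ᴴ) := by
  have hplus : fourierGate d *ᵥ (Pi.single 0 1) = fun n => fourierGate d n 0 := by
    funext n; simp
  have houtput : ∀ (l : List V), (∀ k ∈ l, k ∉ Set.range P.out) →
      (∀ k ∈ l, ∀ c ∈ P.commands, k ∉ c.qudits) → ∀ σ : QuditOp d V,
      outputState P.out (PatternCommand.run P.commands 0
        (onQudits (fourierGate d) l * σ * (onQudits (fourierGate d) l)ᴴ)) =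
        outputState P.out (PatternCommand.run P.commands 0 σ) := by
    intro l
    induction l with
    | nil => simp [onQudits]
    | cons k l ih =>
      intro h1 h2 σ
      have : onQudits (fourierGate d) (k :: l) * σ * (onQudits (fourierGate d) (k :: l))ᴴ =
          onQudits (fourierGate d) l * (onQudit k (fourierGate d) * σ *
            onQudit k (fourierGate d)ᴴ) * (onQudits (fourierGate d) l)ᴴ := by
        simp only [onQudits, Matrix.conjTranspose_mul, onQudit_conjTranspose, Matrix.mul_assoc]
      rw [this, ih (fun k hk => h1 k (by simp [hk])) (fun k hk => h2 k (by simp [hk])),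
        PatternCommand.run_onQudit_mul_mul _ _ _ (h2 k (by simp)), ← onQudit_conjTranspose,
        outputState_unitary_conj P.out (h1 k (by simp)) fourierGate_conjTranspose_mul_self]
  set S := PatternCommand.usedQudits P.commands with hS
  set l₀ := (S \ Finset.univ.map P.inp).toList with hl₀
  set l₁ := (Sᶜ \ Finset.univ.map P.inp).toList with hl₁
  have h0 := onQudits_mul_preparation (inp := P.inp) (fourierGate d) (Pi.single 0 1)
    (l := l₀) (a := fun _ => Pi.single 0 1) (Finset.nodup_toList _)
    (fun k hk => by simpa using (Finset.mem_sdiff.1 (Finset.mem_toList.1 hk)).2) (fun _ _ => rfl)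
  have h1 := onQudits_mul_preparation (inp := P.inp) (fourierGate d) (Pi.single 0 1)
    (l := l₁) (a := fun k => if k ∈ l₀ then fourierGate d *ᵥ Pi.single 0 1 else Pi.single 0 1)
    (Finset.nodup_toList _)
    (fun k hk => by simpa using (Finset.mem_sdiff.1 (Finset.mem_toList.1 hk)).2)
    (fun k hk => by
      have hk := Finset.mem_compl.1 (Finset.mem_sdiff.1 (Finset.mem_toList.1 hk)).1
      rw [if_neg]
      intro h
      exact hk (Finset.mem_sdiff.1 (Finset.mem_toList.1 h)).1)
  rw [← h0] at h1
  replace h1 := h1.trans (preparation_congr (b := fun _ n => fourierGate d n 0) (by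
    intro k hk
    have hk' : k ∉ Finset.univ.map P.inp := by simpa using hk
    by_cases hkS : k ∈ S
    · have : k ∈ l₀ := by simpa [hl₀, hkS] using hk
      simp only [this, if_true, hplus, ite_self]
    · have : k ∈ l₁ := by simpa [hl₁, hkS] using hk
      simp only [this, if_true, hplus]))
  have hunused : ∀ k ∈ l₁, ∀ c ∈ P.commands, k ∉ c.qudits := by
    intro k hk c hc hkc
    have hk := Finset.mem_compl.1 (Finset.mem_sdiff.1 (Finset.mem_toList.1 hk)).1
    exact hk (PatternCommand.mem_usedQudits.2 ⟨c, hc, hkc⟩)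
  have hidle : ∀ k ∈ l₁, k ∉ Set.range P.out := by
    rintro k hk ⟨o, rfl⟩
    obtain ⟨c, hc, hoc⟩ := hP o
      (by simpa using (Finset.mem_sdiff.1 (Finset.mem_toList.1 hk)).2)
    exact hunused _ hk c hc hoc
  have hinit : initialState P.inp (fun n => fourierGate d n 0) ρ =
      onQudits (fourierGate d) l₁ * (onQudits (fourierGate d) l₀ *
        preparation (d := d) P.inp (fun _ => Pi.single 0 1) * ρ * (onQudits (fourierGate d) l₀ *
          preparation (d := d) P.inp (fun _ => Pi.single 0 1))ᴴ) * (onQudits (fourierGate d) l₁)ᴴ := by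
    rw [initialState_eq, ← h1]
    simp only [Matrix.conjTranspose_mul, Matrix.mul_assoc]
  rw [channel, hinit, houtput l₁ hidle hunused]
  refine PatternCommand.outputState_run P.out P.commands ∅ 0 _ P.runnable P.out_not_measured ?_
  simp [PatternCommand.Conditioned, PatternCommand.outcomeProj_empty]

/-- The simulation of a measurement pattern by an unbounded fan-out circuit. -/
noncomputable def toFanoutCircuit (P : MeasurementPattern d V I O) :
    FanoutCircuit d (Wire V) I O where
  inp := P.inp.trans Function.Embedding.inl
  out := P.out.trans Function.Embedding.inl
  gates := ((PatternCommand.usedQudits P.commands \ Finset.univ.map P.inp).toList.map fun k =>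
      .local1 (Sum.inl k) 0) ++
    P.commands.flatMap (PatternCommand.gates (PatternCommand.usedQudits P.commands))
  valid := by
    intro g hg
    simp only [List.mem_append, List.mem_map, List.mem_flatMap] at hg
    rcases hg with ⟨k, _, rfl⟩ | ⟨c, hc, hg⟩
    · trivial
    · exact PatternCommand.valid_of_mem_gates
        (PatternCommand.valid_of_runnable P.runnable c hc) g hg

theorem channel_toFanoutCircuit (P : MeasurementPattern d V I O) (hP : P.NoIdleOutput) :
    P.toFanoutCircuit.channel = P.channel := by
  funext ρ
  have hout : ∀ o, P.out o ∉ PatternCommand.measuredQudits P.commands := by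
    intro o h
    obtain ⟨c, hc, ho⟩ := PatternCommand.mem_measuredQudits.1 h
    exact P.out_not_measured c hc o ho
  rw [P.channel_eq hP, FanoutCircuit.channel, FanoutGate.run_eq, initialState_eq,
    ← outputState_withCopies (S := PatternCommand.usedQudits P.commands) P.out hout]
  simp only [toFanoutCircuit]
  set S := PatternCommand.usedQudits P.commands with hS
  rw [preparation_withCopies P.inp S, FanoutGate.ops_append]
  set l₀ := (S \ Finset.univ.map P.inp).toList
  have h0 := ops_map_local1 l₀ (0 : ZMod d → ℝ) S
  rw [vGate_zero] at h0
  have h1 := PatternCommand.ops_flatMap_gates (S := S) P.runnable fun c hc i hi =>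
    PatternCommand.mem_usedQudits.2 ⟨c, hc, hi⟩
  rw [Finset.empty_union] at h1
  set A := FanoutGate.ops (P.commands.flatMap (PatternCommand.gates S))
  set B := FanoutGate.ops (l₀.map fun k => (.local1 (Sum.inl k) 0 : FanoutGate d (Wire V)))
  set J₀ := basisMap (PatternCommand.withCopies (d := d) S ∅)
  set J := basisMap (PatternCommand.withCopies (d := d) S
    (PatternCommand.measuredQudits P.commands))
  set K := PatternCommand.coherentOps P.commands
  set L := onQudits (fourierGate d) l₀
  set Q := preparation (d := d) P.inp fun _ => Pi.single 0 1
  -- Both output states are conjugations of `ρ` by a single operator, so it is enough to compare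
  -- these two operators.
  have key : A * B * (J₀ * Q) = J * K * (L * Q) := by
    rw [← h1, Matrix.mul_assoc A, ← Matrix.mul_assoc B, h0]
    simp only [Matrix.mul_assoc]
  have e1 : A * B * (J₀ * Q * ρ * (J₀ * Q)ᴴ) * (A * B)ᴴ =
      (A * B * (J₀ * Q)) * ρ * (A * B * (J₀ * Q))ᴴ := by
    rw [Matrix.conjTranspose_mul (A * B) (J₀ * Q)]
    simp only [Matrix.mul_assoc]
  have e2 : J * (K * (L * Q * ρ * (L * Q)ᴴ) * Kᴴ) * Jᴴ =
      (J * K * (L * Q)) * ρ * (J * K * (L * Q))ᴴ := by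
    rw [Matrix.conjTranspose_mul (J * K) (L * Q), Matrix.conjTranspose_mul J K]
    simp only [Matrix.mul_assoc]
  rw [e1, e2, key]

theorem one_le_depth {P : MeasurementPattern d V I O} (h : P.commands ≠ []) : 1 ≤ P.depth :=
  one_le_longestPath h

/-- The layer of Fourier gates has depth at most one and is charged to a command. A pattern without
commands uses no qudits and gives the empty circuit. -/
theorem depth_toFanoutCircuit_le (P : MeasurementPattern d V I O) :
    P.toFanoutCircuit.depth ≤ (4 * d + 7) * P.depth := by
  by_cases h : P.commands = []
  · have : P.toFanoutCircuit.depth ≤ 0 :=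
      (longestPath_le_length _).trans (by simp [toFanoutCircuit, h, PatternCommand.usedQudits])
    omega
  · have h1 : longestPath FanoutGate.DependsOn
        ((PatternCommand.usedQudits P.commands \ Finset.univ.map P.inp).toList.map fun k =>
          (.local1 (Sum.inl k) 0 : FanoutGate d (Wire V))) ≤ 1 := by
      refine longestPath_le_one (List.pairwise_map.2 ((Finset.nodup_toList _).imp ?_))
      intro j k hjk
      simpa [FanoutGate.DependsOn, FanoutGate.qudits] using hjk
    have h2 := PatternCommand.longestPath_flatMap_gates_le
      (S := PatternCommand.usedQudits P.commands) P.runnable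
    refine (longestPath_append_le _ _).trans ((add_le_add h1 h2).trans ?_)
    have := one_le_depth h
    change 1 + (4 * d + 6) * P.depth ≤ _
    nlinarith

/-- There are at most `size` commands, each costing at most `(6 d + 6) (size + 1)`, and at most
`size` Fourier gates. For a nonempty pattern `size + 1 ≤ 2 size`, and the factor `depth` enters only
through `1 ≤ depth`. -/
theorem size_toFanoutCircuit_le (P : MeasurementPattern d V I O) :
    P.toFanoutCircuit.size ≤ (12 * d + 13) * (P.size ^ 2 * P.depth) := by
  have hS : (PatternCommand.usedQudits P.commands).card ≤ P.size :=
    PatternCommand.card_usedQudits_le P.commands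
  have hlen : P.commands.length ≤ P.size := PatternCommand.length_le_sum_card P.commands
  have h1 : PatternCommand.gateSize
      ((PatternCommand.usedQudits P.commands \ Finset.univ.map P.inp).toList.map fun k =>
        (.local1 (Sum.inl k) 0 : FanoutGate d (Wire V))) ≤ P.size := by
    refine le_trans (le_of_eq ?_) ((Finset.card_le_card
      (Finset.sdiff_subset (t := Finset.univ.map P.inp))).trans hS)
    simp [PatternCommand.gateSize, Function.comp_def, FanoutGate.qudits]
  have h2 : PatternCommand.gateSize (P.commands.flatMap
      (PatternCommand.gates (PatternCommand.usedQudits P.commands))) ≤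
      P.commands.length * ((6 * d + 6) * (P.size + 1)) := by
    refine PatternCommand.gateSize_flatMap_le fun c hc =>
      PatternCommand.gateSize_gates_le hS ((Finset.card_le_card ?_).trans hS)
    simpa using PatternCommand.reads_subset_of_runnable P.runnable c hc
  have h3 : P.toFanoutCircuit.size ≤ P.size + P.commands.length * ((6 * d + 6) * (P.size + 1)) := by
    change PatternCommand.gateSize (_ ++ _) ≤ _
    rw [PatternCommand.gateSize_append]
    exact add_le_add h1 h2
  by_cases h : P.commands = []
  · have hs : P.size = 0 := by simp [size, h]
    rw [h, hs, List.length_nil, zero_mul] at h3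
    omega
  · have hd := one_le_depth h
    have hs : 1 ≤ P.size := (List.length_pos_iff.2 h).trans_le hlen
    calc P.toFanoutCircuit.size
        ≤ P.size * P.size + P.size * ((6 * d + 6) * (P.size + P.size)) := by
          refine h3.trans (add_le_add (Nat.le_mul_of_pos_left _ hs) ?_)
          gcongr
      _ = (12 * d + 13) * (P.size ^ 2 * 1) := by ring
      _ ≤ _ := by gcongr

end MeasurementPattern

end Final

theorem mainTheorem2 (d : ℕ) [NeZero d] (hd : 2 ≤ d) :
    ∃ C : ℕ, ∀ (V : Type u) (I : Type v) (O : Type w)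
      [Fintype V] [DecidableEq V] [Fintype I] [DecidableEq I] [Fintype O] [DecidableEq O]
      (P : MeasurementPattern d V I O),
      (P.NoIdleOutput ∨ ∃ U, ImplementsUnitary P.channel U) →
      ∃ (W : Type u) (_ : Fintype W) (_ : DecidableEq W) (F : FanoutCircuit d W I O),
        F.channel = P.channel ∧
        (∀ U, ImplementsUnitary P.channel U → ImplementsUnitary F.channel U) ∧
        F.depth ≤ C * P.depth ∧
        F.size ≤ C * (P.size ^ 2 * P.depth) := by

  -- The constant of the size bound, which dominates the `4 d + 7` of the depth bound.
  refine ⟨12 * d + 13, ?_⟩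
  intro V I O _ _ _ _ _ _ P hP
  have hidle : P.NoIdleOutput := by
    rcases hP with h | ⟨U, hU⟩
    · exact h
    · exact noIdleOutput_of_implementsUnitary hd P hU
  have hch := P.channel_toFanoutCircuit hidle
  refine ⟨Wire V, inferInstance, inferInstance, P.toFanoutCircuit, hch, fun U hU => hch ▸ hU,
    P.depth_toFanoutCircuit_le.trans (Nat.mul_le_mul_right _ (by omega)),
    P.size_toFanoutCircuit_le⟩
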